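/- **Notation.** Vectors in $\mathbb C^2$ are written $z=(z^{(1)},z^{(2)})^T$; $*$ is complex conjugation; $W(u,v)=u^{(1)}v^{(2)}-u^{(2)}v^{(1)}$; $S_+z=(z^{(2)*},z^{(1)*})^T$; $\sqrt{\ }$ is the principal square root; $$U(\lambda,q,r)=\begin{pmatrix}-\lambda&q\\ r&\lambda\end{pmatrix},\qquad V(\lambda,q,r)=i\begin{pmatrix}-2\lambda^2+qr&2\lambda q-q_x\\ 2\lambda r+r_x&2\lambda^2-qr\end{pmatrix},\qquad H(\varphi)=\frac12\begin{pmatrix}-\varphi^{(1)}\varphi^{(2)}&(\varphi^{(1)})^2\\-(\varphi^{(2)})^2&\varphi^{(1)}\varphi^{(2)}\end{pmatrix}.$$ **The NLS$^+$ESCS with $(m,n)$ sources.** Let $\lambda_1,\dots,\lambda_m,\zeta_1,\dots,\zeta_n\in\mathbb C$ with $\operatorname{Re}\zeta_j=0$ and the $2m+n$ numbers $\lambda_j,-\lambda_j^*,\zeta_j$ distinct. A solution $(q,\varphi_1,\dots,\varphi_m,w_1,\dots,w_n)$, with $q,w_j$ complex valued and $\varphi_j$ $\mathbb C^2$-valued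 functions of $(x,t)$, satisfies $$\varphi_{j,x}=U(\lambda_j,q,q^*)\varphi_j,\qquad w_{j,x}=-\zeta_jw_j+q\,w_j^*,\qquad q_t=i(2|q|^2q-q_{xx})+\sum_{j=1}^m\big[(\varphi_j^{(1)})^2+(\varphi_j^{(2)*})^2\big]+\sum_{j=1}^nw_j^2 .$$ Its Lax pair with parameter $\lambda\notin\{\lambda_j,-\lambda_j^*,\zeta_j\}$ is $$\psi_x=U(\lambda,q,q^*)\psi,\qquad \psi_t=V(\lambda,q,q^*)\psi+\sum_{j=1}^m\Big[\frac{H(\varphi_j)}{\lambda-\lambda_j}+\frac{H(S_+\varphi_j)}{\lambda+\lambda_j^*}\Big]\psi+\sum_{j=1}^n\frac{H((w_j,w_j^*)^T)}{\lambda-\zeta_j}\psi .\tag{L}$$ All equations are understood classically (the derivatives that occur exist). **Data.** Let $\Omega\subseteq\mathbb R^2$ be open and let $(q,\varphi_1,\dots,\varphi_m,w_1,\dots,w_n)$ be a solution of the NLS$^+$ESCS with $(m,n)$ sources on $\Omega$. Let $\zeta_{n+1},\dots,\zeta_{n+N}$ with $\operatorname{Re}\zeta_{n+j}=0$ and $\lambda_{m+1},\dots,\lambda_{m+M}$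 with $\operatorname{Re}\lambda_{m+j}\ne0$ be such that all the numbers $\lambda_j,-\lambda_j^*$ $(1\le j\le m+M)$ and $\zeta_j$ $(1\le j\le n+N)$ are distinct. For $1\le j\le N$ let $f_j=f_j(\lambda)$, and for $1\le j\le M$ let $g_j=g_j(\lambda)$, be families of solutions of (L) on $\Omega$, defined for $\lambda$ near $\zeta_{n+j}$ and near $\lambda_{m+j}$ respectively, holomorphic in $\lambda$ and $C^1$ in $(\lambda,x,t)$, with $f_j^{(1)}=f_j^{(2)*}$ for all purely imaginary $\lambda$ near $\zeta_{n+j}$. Let $c_j(t)$ $(1\le j\le N)$ be differentiable real functions with $\dot c_j\ge0$ and $d_j(t)$ $(1\le j\le M)$ differentiable complex functions. **Determinants.** For families $f,g$ used at parameters $\mu\neq\nu$ let $\sigma(f,g)=-\frac{W(f,g)}{2(\mu-\nu)}$, and let $\sigma(f,f)=\frac12W(f,\partial_\mu f)$; $S_+g$ is the family $\lambda\mapsto S_+(g(-\lambda^*))$, used at $-\nu^*$. For pairs $\{C_i,h_i\}$, $1\le i\le K$, put $A=(\delta_{ij}C_i+\sigma(h_i,h_j))_{K\times K}$, $b=(\sigma(h_1,h),\dots,\sigma(h_K,h))^T$,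 $\alpha^{(k)}=(h_1^{(k)},\dots,h_K^{(k)})$ and, for $k=1,2$, $$W_0=\det A,\qquad W_1^{(k)}(\,\cdot\,;h)=\det\begin{pmatrix}A&b\\ \alpha^{(k)}&h^{(k)}\end{pmatrix},\qquad W_2^{(k)}(\,\cdot\,;u)=\det\begin{pmatrix}A&(\alpha^{(k)})^T\\ \alpha^{(k)}&u\end{pmatrix},\qquad W_1=(W_1^{(1)},W_1^{(2)})^T .$$ Let $F_j=\{c_j,f_j\}$, $G_j=\{d_j,g_j\}$, $G_j'=\{d_j^*,S_+g_j\}$, write $\mathcal F$ for the list $F_1,\dots,F_N,G_1,G_1',\dots,G_M,G_M'$, and let $\Delta=W_0(\mathcal F)$. Define, on $D=\{(x,t)\in\Omega:\Delta(x,t)\ne0\}$, $$\bar\psi=\Delta^{-1}W_1(\mathcal F;\psi),\qquad \bar q=q+\Delta^{-1}W_2^{(1)}(\mathcal F;0),$$ $$\bar\varphi_j=\Delta^{-1}W_1(\mathcal F;\varphi_j)\ (1\le j\le m),\qquad \bar\varphi_{m+j}=\sqrt{\dot d_j}\,(d_j\Delta)^{-1}W_1(\mathcal F;g_j)\ (1\le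 j\le M),$$ $$\bar w_j=\Delta^{-1}W_1^{(1)}(\mathcal F;(w_j,w_j^*)^T)\ (1\le j\le n),\qquad \bar w_{n+j}=\sqrt{\dot c_j}\,(c_j\Delta)^{-1}W_1^{(1)}(\mathcal F;f_j)\ (1\le j\le N).$$ Here $W_1(\mathcal F;f_j)$ is $c_j$ times $W_1(\mathcal F\setminus F_j;f_j)$, and $W_1(\mathcal F;g_j)$ is $d_j$ times $W_1(\mathcal F\setminus G_j;g_j)$; where $c_j(t)=0$ or $d_j(t)=0$, the quotient by it is read as the other factor. **Proposition (general multi-times repeated Darboux transformation for the NLS$^+$ESCS).** On $D$: 1. for every $\lambda\notin\{\lambda_j,-\lambda_j^*\ (j\le m+M),\ \zeta_j\ (j\le n+N)\}$ and every solution $\psi$ on $\Omega$ of (L) for the original solution, $\bar\psi$ satisfies (L), with the same $\lambda$, for $(\bar q,\bar\varphi_1,\dots,\bar\varphi_{m+M},\bar w_1,\dots,\bar w_{n+N})$; 2. $(\bar q,\bar\varphi_1,\dots,\bar\varphi_{m+M},\bar w_1,\dots,\bar w_{n+N})$ is a solution of the NLS$^+$ESCS with $(m+M,n+N)$ sources,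 with constants $\lambda_1,\dots,\lambda_{m+M},\zeta_1,\dots,\zeta_{n+N}$; 3. $\Delta$ is real (on all of $\Omega$), and $|\bar q|^2=|q|^2-\partial_x^2\log|\Delta|$. -/

import Mathlib

open scoped ComplexConjugate Topology

noncomputable section

namespace NLSESCS

/-! ## Vectors, the spectral problem and the equation -/

/-- The Wronskian `W(u,v) = u⁽¹⁾ v⁽²⁾ - u⁽²⁾ v⁽¹⁾` (components are indexed by `0, 1 : Fin 2`). -/
def wronskian (u v : Fin 2 → ℂ) : ℂ := u 0 * v 1 - u 1 * v 0

/-- The map `S₊ (z⁽¹⁾, z⁽²⁾) = (z⁽²⁾*, z⁽¹⁾*)`. -/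
def sPlus (z : Fin 2 → ℂ) : Fin 2 → ℂ := ![conj (z 1), conj (z 0)]

/-- `U(λ,q,r)`, for values `q`, `r` at one point. -/
def laxU (lam q r : ℂ) : Matrix (Fin 2) (Fin 2) ℂ :=
  !![-lam, q; r, lam]

/-- `V(λ,q,r)` at `(x,t)`. -/
def laxV (lam : ℂ) (q r : ℝ → ℝ → ℂ) (x t : ℝ) : Matrix (Fin 2) (Fin 2) ℂ :=
  Complex.I •
    !![-2 * lam ^ 2 + q x t * r x t, 2 * lam * q x t - deriv (fun y => q y t) x;
       2 * lam * r x t + deriv (fun y => r y t) x, 2 * lam ^ 2 - q x t * r x t]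

/-- The matrix `H(φ)`. -/
def sourceH (p : Fin 2 → ℂ) : Matrix (Fin 2) (Fin 2) ℂ :=
  (1 / 2 : ℂ) • !![-(p 0 * p 1), p 0 ^ 2; -(p 1 ^ 2), p 0 * p 1]

/-- The vector `(w, w*)ᵀ`. -/
def realVec (w : ℂ) : Fin 2 → ℂ := ![w, conj w]

/-- `f` is twice differentiable at `x`. -/
def TwiceDifferentiableAt {E : Type*} [NormedAddCommGroup E] [NormedSpace ℝ E]
    (f : ℝ → E) (x : ℝ) : Prop :=
  (∀ᶠ y in 𝓝 x, DifferentiableAt ℝ f y) ∧ DifferentiableAt ℝ (deriv f) x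

/-- The list `λ₁,…,λ_m, -λ₁*,…,-λ_m*, ζ₁,…,ζ_n` of the poles of the Lax pair. -/
def poles {m n : ℕ} (lam : Fin m → ℂ) (zeta : Fin n → ℂ) : (Fin m ⊕ Fin m) ⊕ Fin n → ℂ :=
  Sum.elim (Sum.elim lam (fun j => -conj (lam j))) zeta

/-- The `2m+n` constants `λ_j, -λ_j*, ζ_j` are distinct and the `ζ_j` are purely imaginary. -/
structure AdmissibleSpectrum {m n : ℕ} (lam : Fin m → ℂ) (zeta : Fin n → ℂ) : Prop where
  distinct : Function.Injective (poles lam zeta)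
  zeta_re : ∀ j, (zeta j).re = 0

/-- `(q, φ₁,…,φ_m, w₁,…,w_n)` is a (classical) solution of the NLS⁺ESCS with spectral constants
`λ_j`, `ζ_j` at the points of `D`, a set of pairs `(x,t)`. -/
structure IsSolution {m n : ℕ} (D : Set (ℝ × ℝ)) (lam : Fin m → ℂ) (zeta : Fin n → ℂ)
    (q : ℝ → ℝ → ℂ) (phi : Fin m → ℝ → ℝ → Fin 2 → ℂ) (w : Fin n → ℝ → ℝ → ℂ) : Prop where
  spectrum : AdmissibleSpectrum lam zeta
  phi_x : ∀ j, ∀ x t, (x, t) ∈ D →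
    HasDerivAt (fun y => phi j y t)
      ((laxU (lam j) (q x t) (conj (q x t))).mulVec (phi j x t)) x
  w_x : ∀ j, ∀ x t, (x, t) ∈ D →
    HasDerivAt (fun y => w j y t) (-zeta j * w j x t + q x t * conj (w j x t)) x
  q_x : ∀ x t, (x, t) ∈ D → TwiceDifferentiableAt (fun y => q y t) x
  q_t : ∀ x t, (x, t) ∈ D →
    HasDerivAt (fun s => q x s)
      (Complex.I * (2 * (‖q x t‖ : ℂ) ^ 2 * q x t - deriv (deriv (fun y => q y t)) x)
        + ∑ j, (phi j x t 0 ^ 2 + conj (phi j x t 1) ^ 2) + ∑ j, w j x t ^ 2) t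

/-- The matrix of the `t`-part of the Lax pair of the NLS⁺ESCS. -/
def laxR {m n : ℕ} (lam : Fin m → ℂ) (zeta : Fin n → ℂ)
    (q : ℝ → ℝ → ℂ) (phi : Fin m → ℝ → ℝ → Fin 2 → ℂ) (w : Fin n → ℝ → ℝ → ℂ)
    (mu : ℂ) (x t : ℝ) : Matrix (Fin 2) (Fin 2) ℂ :=
  laxV mu q (fun y s => conj (q y s)) x t
    + ∑ j, ((mu - lam j)⁻¹ • sourceH (phi j x t)
        + (mu + conj (lam j))⁻¹ • sourceH (sPlus (phi j x t)))
    + ∑ j, (mu - zeta j)⁻¹ • sourceH (realVec (w j x t))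

/-- `ψ` solves the Lax pair of the NLS⁺ESCS with spectral parameter `mu` at the points of `D`. -/
structure IsLaxSolution {m n : ℕ} (D : Set (ℝ × ℝ)) (lam : Fin m → ℂ) (zeta : Fin n → ℂ)
    (q : ℝ → ℝ → ℂ) (phi : Fin m → ℝ → ℝ → Fin 2 → ℂ) (w : Fin n → ℝ → ℝ → ℂ)
    (mu : ℂ) (psi : ℝ → ℝ → Fin 2 → ℂ) : Prop where
  psi_x : ∀ x t, (x, t) ∈ D →
    HasDerivAt (fun y => psi y t)
      ((laxU mu (q x t) (conj (q x t))).mulVec (psi x t)) x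
  psi_t : ∀ x t, (x, t) ∈ D →
    HasDerivAt (fun s => psi x s) ((laxR lam zeta q phi w mu x t).mulVec (psi x t)) t

/-! ## Families of solutions, the bracket `σ` and the determinants -/

/-- A vector function `f(λ) = f(λ; x, t)` of the spectral parameter `λ`, together with the value
`param` of `λ` at which it is used. -/
structure SpectralFamily where
  param : ℂ
  fn : ℂ → ℝ → ℝ → Fin 2 → ℂ

namespace SpectralFamily

/-- The vector function at its own spectral parameter. -/
def val (F : SpectralFamily) (x t : ℝ) : Fin 2 → ℂ := F.fn F.param x t

/-- A single vector function, regarded as attached to the parameter `mu`. -/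
def single (mu : ℂ) (h : ℝ → ℝ → Fin 2 → ℂ) : SpectralFamily := ⟨mu, fun _ => h⟩

/-- `S₊` on families: if `f(λ)` has parameter `μ`, then `S₊ f` is `λ ↦ S₊ (f(-λ*))`, with
parameter `-μ*`. -/
def sPlus (F : SpectralFamily) : SpectralFamily :=
  ⟨-conj F.param, fun mu x t => NLSESCS.sPlus (F.fn (-conj mu) x t)⟩

end SpectralFamily

/-- Near `λ = F.param`, `F` is a family of solutions of the Lax pair with parameter `λ`,
continuously differentiable in `(λ,x,t)` and holomorphic in `λ`. -/
def IsLaxFamily {m n : ℕ} (D : Set (ℝ × ℝ)) (lam : Fin m → ℂ) (zeta : Fin n → ℂ)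
    (q : ℝ → ℝ → ℂ) (phi : Fin m → ℝ → ℝ → Fin 2 → ℂ) (w : Fin n → ℝ → ℝ → ℂ)
    (F : SpectralFamily) : Prop :=
  ∃ O : Set ℂ, IsOpen O ∧ F.param ∈ O ∧
    ContDiffOn ℝ 1 (fun z : ℂ × (ℝ × ℝ) => F.fn z.1 z.2.1 z.2.2) (O ×ˢ D) ∧
    (∀ x t, (x, t) ∈ D → DifferentiableOn ℂ (fun mu => F.fn mu x t) O) ∧
    ∀ mu ∈ O, IsLaxSolution D lam zeta q phi w mu (F.fn mu)

/-- `f⁽¹⁾(λ) = f⁽²⁾(λ)*` for all purely imaginary `λ` near `F.param`. -/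
def IsSelfConjugate (D : Set (ℝ × ℝ)) (F : SpectralFamily) : Prop :=
  ∀ᶠ mu in 𝓝 F.param, mu.re = 0 →
    ∀ x t, (x, t) ∈ D → F.fn mu x t 0 = conj (F.fn mu x t 1)

/-- The bracket `σ`: `σ(f,g) = -W(f,g)/(2(μ-ν))` for parameters `μ ≠ ν`, and
`σ(f,f) = ½ W(f, ∂_μ f)`. -/
def sigma (F G : SpectralFamily) (x t : ℝ) : ℂ :=
  if F.param = G.param then
    1 / 2 * wronskian (F.val x t) (deriv (fun mu => G.fn mu x t) G.param)
  else
    -wronskian (F.val x t) (G.val x t) / (2 * (F.param - G.param))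

section Determinants

variable {ι : Type} [Fintype ι] [DecidableEq ι]

/-- The matrix `A = (δ_{ij} c_i(t) + σ(f_i,f_j))`. -/
def gram (C : ι → ℝ → ℂ) (F : ι → SpectralFamily) (x t : ℝ) : Matrix ι ι ℂ :=
  Matrix.of fun i j => (if i = j then C i t else 0) + sigma (F i) (F j) x t

/-- `W₀({c_i,f_i}) = det A`. -/
def W0 (C : ι → ℝ → ℂ) (F : ι → SpectralFamily) (x t : ℝ) : ℂ :=
  (gram C F x t).det

/-- The vector `W₁({c_i,f_i}; h)`; its `k`-th entry is the determinant of `A` bordered by the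
column `σ(f_i,h)`, the row `f_i⁽ᵏ⁾` and the corner `h⁽ᵏ⁾`. -/
def W1 (C : ι → ℝ → ℂ) (F : ι → SpectralFamily) (h : SpectralFamily) (x t : ℝ) : Fin 2 → ℂ :=
  fun k => (Matrix.fromBlocks (gram C F x t)
    (Matrix.of fun i (_ : Unit) => sigma (F i) h x t)
    (Matrix.of fun (_ : Unit) j => (F j).val x t k)
    (Matrix.of fun (_ _ : Unit) => h.val x t k)).det

/-- `W₂⁽ᵏ⁾({c_i,f_i}; u)`: the determinant of `A` bordered by the column and the row `f_i⁽ᵏ⁾` and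
the corner `u`. -/
def W2 (k : Fin 2) (C : ι → ℝ → ℂ) (F : ι → SpectralFamily) (u : ℂ) (x t : ℝ) : ℂ :=
  (Matrix.fromBlocks (gram C F x t)
    (Matrix.of fun i (_ : Unit) => (F i).val x t k)
    (Matrix.of fun (_ : Unit) j => (F j).val x t k)
    (Matrix.of fun (_ _ : Unit) => u)).det

/-- The vector `c_i⁻¹ W₁({c_1,f_1},…; f_i)`. `W₁(…; f_i)` is `c_i` times the `W₁` of the remaining
pairs, so where `c_i(t) = 0` the quotient is read as the latter. -/
def W1Div (C : ι → ℝ → ℂ) (F : ι → SpectralFamily) (i : ι) (x t : ℝ) : Fin 2 → ℂ :=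
  if C i t = 0 then
    W1 (fun j : {j : ι // j ≠ i} => C j) (fun j : {j : ι // j ≠ i} => F j) (F i) x t
  else
    (C i t)⁻¹ • W1 C F (F i) x t

end Determinants

/-! ## The transformation -/

/-- The data of the transformation: pairs `F_j = {c_j, f_j}` with `f_j` at the parameter `zeta j`,
and `G_j = {d_j, g_j}` with `g_j` at the parameter `lam j`. -/
structure DarbouxData (M N : ℕ) where
  zeta : Fin N → ℂ
  f : Fin N → ℂ → ℝ → ℝ → Fin 2 → ℂ
  c : Fin N → ℝ → ℝ
  lam : Fin M → ℂ
  g : Fin M → ℂ → ℝ → ℝ → Fin 2 → ℂ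
  d : Fin M → ℝ → ℂ

namespace DarbouxData

variable {M N m n : ℕ} (T : DarbouxData M N)

/-- The family `f_j`. -/
def fFam (j : Fin N) : SpectralFamily := ⟨T.zeta j, T.f j⟩

/-- The family `g_j`. -/
def gFam (j : Fin M) : SpectralFamily := ⟨T.lam j, T.g j⟩

/-- The first members of the pairs `F_j`, `G_j`, `G'_j`; the determinants do not depend on the
order in which the pairs are listed. -/
def scalars : Fin N ⊕ (Fin M ⊕ Fin M) → ℝ → ℂ :=
  Sum.elim (fun j t => (T.c j t : ℂ)) (Sum.elim T.d (fun j t => conj (T.d j t)))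

/-- The second members `f_j`, `g_j`, `S₊ g_j` of the pairs `F_j`, `G_j`, `G'_j`. -/
def families : Fin N ⊕ (Fin M ⊕ Fin M) → SpectralFamily :=
  Sum.elim T.fFam (Sum.elim T.gFam (fun j => (T.gFam j).sPlus))

/-- `Δ = W₀(F_1,…,F_N,G_1,G'_1,…,G_M,G'_M)`. -/
def Delta (x t : ℝ) : ℂ := W0 T.scalars T.families x t

/-- `Δ⁻¹ W₁(F_1,…,G'_M; h)` for a vector function `h` attached to the parameter `mu`. -/
def transform (mu : ℂ) (h : ℝ → ℝ → Fin 2 → ℂ) (x t : ℝ) : Fin 2 → ℂ :=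
  (T.Delta x t)⁻¹ • W1 T.scalars T.families (SpectralFamily.single mu h) x t

/-- The new potential `q̄`. -/
def qBar (q : ℝ → ℝ → ℂ) (x t : ℝ) : ℂ :=
  q x t + (T.Delta x t)⁻¹ * W2 0 T.scalars T.families 0 x t

/-- The new sources `φ̄_1,…,φ̄_{m+M}`. -/
def phiBar (lam : Fin m → ℂ) (phi : Fin m → ℝ → ℝ → Fin 2 → ℂ) :
    Fin (m + M) → ℝ → ℝ → Fin 2 → ℂ :=
  Fin.append (fun j => T.transform (lam j) (phi j))
    (fun j x t => (Complex.sqrt (deriv (T.d j) t) * (T.Delta x t)⁻¹) •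
      W1Div T.scalars T.families (Sum.inr (Sum.inl j)) x t)

/-- The new sources `w̄_1,…,w̄_{n+N}`. -/
def wBar (zeta : Fin n → ℂ) (w : Fin n → ℝ → ℝ → ℂ) : Fin (n + N) → ℝ → ℝ → ℂ :=
  Fin.append (fun j x t => T.transform (zeta j) (fun y s => realVec (w j y s)) x t 0)
    (fun j x t => (Real.sqrt (deriv (T.c j) t) : ℂ) * (T.Delta x t)⁻¹ *
      W1Div T.scalars T.families (Sum.inl j) x t 0)

end DarbouxData

end NLSESCS

end

open scoped ComplexConjugate Topology

noncomputable section

namespace NLSESCS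

open Matrix

/-! ## The bilinear form of the inverse of a symmetric matrix -/

section Algebra

variable {ι : Type} [Fintype ι] [DecidableEq ι]

/-! Let `A` be the matrix with determinant `Δ`, and let `a₁`, `a₂` be the vectors of first and
second components of the families. The Schur complement turns every bordered determinant divided by
`Δ` into `u - yᵀ A⁻¹ b` (`det_bordered`), so `q̄ = q - a₁ᵀ A⁻¹ a₁` and `ψ̄⁽ᵏ⁾ = ψ⁽ᵏ⁾ - aₖᵀ A⁻¹ b`,
where `b` collects the brackets of the families with `ψ`.

Two facts about `A` carry the proof. It is symmetric, and its commutator with the diagonal matrix of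
spectral parameters has rank two, built from `a₁` and `a₂`; hence parameters can be moved through
`A⁻¹` at the cost of products of scalars `yᵀ A⁻¹ z` (`bil_mul_right`). Its derivatives are sums of
rank-one matrices: `A_x` is half of `a₁ a₂ᵀ + a₂ a₁ᵀ`, and `A_t` consists of such terms in `a₁`,
`a₂` plus `∑ vₖ vₖᵀ`. Since the derivative of `A⁻¹` is `-A⁻¹ A' A⁻¹`, each derivative needed is
again a polynomial in the scalars `yᵀ A⁻¹ z`, and the equations become algebraic identities
(`IsXFlow.hasDerivAt_dressed`, `IsTFlow.hasDerivAt_dressed`, `IsTFlow.hasDerivAt_bil_11`).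

For an old source, `vₖ` is its vector of brackets with the families. The derivatives of the scalars
add a diagonal matrix to `A_t`, which is `∑ vᵢ vᵢᵀ` with `vᵢ` a square root times a basis vector.
The new sources are thus dressings, up to sign, of zero sources whose bracket vectors are these
`vᵢ`, and old and new sources obey one computation (`IsDarbouxSetup.isTFlow`). The sign is harmless
because sources enter `q_t` and the Lax matrix quadratically.

The diagonal entries of `A` contain `∂_λ f`; Cauchy's integral formula lets this derivative commute
with `∂_x` and `∂_t`.

The reduction `r = q*` survives because `S₊` permutes the families, so that conjugating `A` amounts
to permuting its indices (`conj_mat`, `conj_bil`). This makes `Δ` real and gives `q̄* = q* - a₂ᵀ A⁻¹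
a₂`. Finally `(log |Δ|)_x = a₁ᵀ A⁻¹ a₂`, whose derivative is `|q|² - |q̄|²`. -/

/-- The bilinear form `(y, z) ↦ yᵀ A⁻¹ z`. -/
def bil (A : Matrix ι ι ℂ) (y z : ι → ℂ) : ℂ := y ⬝ᵥ (A⁻¹ *ᵥ z)

variable {A : Matrix ι ι ℂ}

lemma bil_add_left (y y' z : ι → ℂ) : bil A (y + y') z = bil A y z + bil A y' z := by
  simp [bil]

lemma bil_add_right (y z z' : ι → ℂ) : bil A y (z + z') = bil A y z + bil A y z' := by
  simp [bil, mulVec_add]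

lemma bil_sub_left (y y' z : ι → ℂ) : bil A (y - y') z = bil A y z - bil A y' z := by
  simp [bil]

lemma bil_sub_right (y z z' : ι → ℂ) : bil A y (z - z') = bil A y z - bil A y z' := by
  simp [bil, mulVec_sub]

lemma bil_neg_left (y z : ι → ℂ) : bil A (-y) z = -bil A y z := by
  simp [bil]

lemma bil_neg_right (y z : ι → ℂ) : bil A y (-z) = -bil A y z := by
  simp [bil, mulVec_neg]

lemma bil_smul_left (a : ℂ) (y z : ι → ℂ) : bil A (a • y) z = a * bil A y z := by
  simp [bil]

lemma bil_smul_right (a : ℂ) (y z : ι → ℂ) : bil A y (a • z) = a * bil A y z := by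
  simp [bil, mulVec_smul]

lemma bil_sum_left {κ : Type*} (s : Finset κ) (y : κ → ι → ℂ) (z : ι → ℂ) :
    bil A (∑ k ∈ s, y k) z = ∑ k ∈ s, bil A (y k) z := by
  simp [bil, sum_dotProduct]

lemma bil_sum_right {κ : Type*} (s : Finset κ) (y : ι → ℂ) (z : κ → ι → ℂ) :
    bil A y (∑ k ∈ s, z k) = ∑ k ∈ s, bil A y (z k) := by
  simp [bil, mulVec_sum, dotProduct_sum]

lemma bil_comm (hs : A.IsSymm) (y z : ι → ℂ) : bil A y z = bil A z y := by
  have h : (A⁻¹)ᵀ = A⁻¹ := by rw [transpose_nonsing_inv, hs]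
  rw [bil, bil, dotProduct_mulVec, ← mulVec_transpose, h, dotProduct_comm]

lemma bil_self_col (hA : A.det ≠ 0) (y : ι → ℂ) (j : ι) : bil A y (fun i => A i j) = y j := by
  have h : A⁻¹ *ᵥ (fun i => A i j) = Pi.single j 1 := by
    have : (fun i => A i j) = A *ᵥ Pi.single j 1 := by ext i; simp
    rw [this, mulVec_mulVec, nonsing_inv_mul _ hA.isUnit, one_mulVec]
  simp [bil, h]

/-- The bilinear form `(y, z) ↦ yᵀ A⁻¹ B A⁻¹ z`. -/
def sand (A B : Matrix ι ι ℂ) (y z : ι → ℂ) : ℂ := y ⬝ᵥ ((A⁻¹ * B * A⁻¹) *ᵥ z)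

lemma sand_add (B C : Matrix ι ι ℂ) (y z : ι → ℂ) :
    sand A (B + C) y z = sand A B y z + sand A C y z := by
  simp [sand, mul_add, add_mul, add_mulVec]

lemma sand_sub (B C : Matrix ι ι ℂ) (y z : ι → ℂ) :
    sand A (B - C) y z = sand A B y z - sand A C y z := by
  simp [sand, mul_sub, sub_mul, sub_mulVec]

lemma sand_smul (a : ℂ) (B : Matrix ι ι ℂ) (y z : ι → ℂ) :
    sand A (a • B) y z = a * sand A B y z := by
  simp [sand, smul_mulVec]

lemma sand_sum {κ : Type*} (s : Finset κ) (B : κ → Matrix ι ι ℂ) (y z : ι → ℂ) :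
    sand A (∑ k ∈ s, B k) y z = ∑ k ∈ s, sand A (B k) y z := by
  simp [sand, Finset.mul_sum, Finset.sum_mul, sum_mulVec, dotProduct_sum]

/-- A rank-one middle factor splits the form into a product. This is what keeps derivatives of `bil`
inside the algebra generated by `bil`. -/
lemma sand_vecMulVec (u v y z : ι → ℂ) :
    sand A (vecMulVec u v) y z = bil A y u * bil A v z := by
  rw [sand, bil, bil, ← mulVec_mulVec, ← mulVec_mulVec, vecMulVec_mulVec, mulVec_smul]
  simp [mul_comm]

/-- Moving a diagonal matrix through `A⁻¹`. -/
lemma bil_mul_right (hA : A.det ≠ 0) {mu a1 a2 : ι → ℂ}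
    (hcomm : ∀ i j, (mu i - mu j) * A i j = -(1 / 2) * (a1 i * a2 j - a2 i * a1 j))
    (y z : ι → ℂ) :
    bil A y (mu * z) = bil A (mu * y) z - 1 / 2 * (bil A y a1 * bil A a2 z)
      + 1 / 2 * (bil A y a2 * bil A a1 z) := by
  have h1 : diagonal mu * A - A * diagonal mu
      = (-(1 / 2 : ℂ)) • (vecMulVec a1 a2 - vecMulVec a2 a1) := by
    ext i j
    simp only [Matrix.sub_apply, diagonal_mul, mul_diagonal, Matrix.smul_apply, vecMulVec_apply,
      smul_eq_mul]
    linear_combination hcomm i j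
  -- Conjugating the commutator by `A⁻¹` preserves its rank, so the defect of moving `mu` across is
  -- a rank-two matrix.
  have h2 : A⁻¹ * diagonal mu - diagonal mu * A⁻¹
      = A⁻¹ * (diagonal mu * A - A * diagonal mu) * A⁻¹ := by
    rw [mul_sub, sub_mul, ← mul_assoc, mul_assoc _ A, mul_nonsing_inv _ hA.isUnit, mul_one,
      ← mul_assoc, nonsing_inv_mul _ hA.isUnit, one_mul]
  have h3 : y ⬝ᵥ ((A⁻¹ * diagonal mu - diagonal mu * A⁻¹) *ᵥ z)
      = bil A y (mu * z) - bil A (mu * y) z := by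
    have hz : diagonal mu *ᵥ z = mu * z := by ext i; simp [mulVec_diagonal]
    rw [sub_mulVec, dotProduct_sub, ← mulVec_mulVec, ← mulVec_mulVec, hz, bil, bil]
    congr 1
    simp [dotProduct, mulVec_diagonal, mul_left_comm, mul_assoc]
  have h4 : y ⬝ᵥ ((A⁻¹ * diagonal mu - diagonal mu * A⁻¹) *ᵥ z)
      = -(1 / 2) * (bil A y a1 * bil A a2 z - bil A y a2 * bil A a1 z) := by
    rw [h2, h1]
    change sand A _ y z = _
    rw [sand_smul, sand_sub, sand_vecMulVec, sand_vecMulVec]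
  linear_combination h4 - h3

/-- A determinant bordered by one row and one column. -/
lemma det_bordered (hA : A.det ≠ 0) (b y : ι → ℂ) (u : ℂ) :
    (fromBlocks A (of fun i (_ : Unit) => b i) (of fun (_ : Unit) j => y j)
      (of fun (_ _ : Unit) => u)).det = A.det * (u - bil A y b) := by
  let _ := A.invertibleOfIsUnitDet hA.isUnit
  rw [det_fromBlocks₁₁, invOf_eq_nonsing_inv]
  congr 1
  rw [det_unique]
  simp [bil, mul_apply, dotProduct, mulVec, Finset.sum_mul, Finset.mul_sum]
  rw [Finset.sum_comm]
  simp [mul_assoc]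

/-- A determinant bordered by a row and by one of the columns of the full matrix. -/
lemma det_bordered_ne (hA : A.det ≠ 0) (i : ι) (y : ι → ℂ) :
    (fromBlocks (of fun j k : {j : ι // j ≠ i} => A j k)
      (of fun (j : {j : ι // j ≠ i}) (_ : Unit) => A j i)
      (of fun (_ : Unit) (j : {j : ι // j ≠ i}) => y j)
      (of fun (_ _ : Unit) => y i)).det = A.det * bil A y (Pi.single i 1) := by
  -- The border index is sent to the missing index `i`; the bordered matrix is then `A` with row `i`
  -- replaced by `y`, and Cramer's rule applies.
  let e : {j : ι // j ≠ i} ⊕ Unit ≃ ι :=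
    { toFun := Sum.elim Subtype.val (fun _ => i)
      invFun := fun j => if h : j = i then Sum.inr () else Sum.inl ⟨j, h⟩
      left_inv := by
        rintro (⟨j, hj⟩ | _)
        · simp [hj]
        · simp
      right_inv := by
        intro j
        by_cases h : j = i <;> simp [h] }
  have h1 : (fromBlocks (of fun j k : {j : ι // j ≠ i} => A j k)
      (of fun (j : {j : ι // j ≠ i}) (_ : Unit) => A j i)
      (of fun (_ : Unit) (j : {j : ι // j ≠ i}) => y j)
      (of fun (_ _ : Unit) => y i)) = (A.updateRow i y).submatrix e e := by
    ext j k
    obtain ⟨j, hj⟩ | _ := j <;> obtain ⟨k, hk⟩ | _ := k <;> simp [e, updateRow_apply, *]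
  rw [h1, det_submatrix_equiv_self, ← cramer_transpose_apply]
  have h2 : cramer Aᵀ y = A.det • ((A⁻¹)ᵀ *ᵥ y) := by
    rw [cramer_eq_adjugate_mulVec, transpose_nonsing_inv, inv_def, smul_mulVec, smul_smul,
      det_transpose, Ring.mul_inverse_cancel _ hA.isUnit, one_smul]
  rw [h2, bil, dotProduct_mulVec, ← mulVec_transpose]
  simp

end Algebra

/-! ## Derivatives -/

section Derivatives

variable {ι : Type} [Fintype ι] [DecidableEq ι]

-- The statement is entrywise, so no norm on matrices appears in it; the operator norm serves only
-- to apply the derivative of inversion in a normed ring.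
open scoped Matrix.Norms.Operator in
lemma hasDerivAt_matrix_inv_apply {A : ℝ → Matrix ι ι ℂ} {A' : Matrix ι ι ℂ} {s : ℝ}
    (h : ∀ i j, HasDerivAt (fun r => A r i j) (A' i j) s) (hA : (A s).det ≠ 0) (i j : ι) :
    HasDerivAt (fun r => (A r)⁻¹ i j) (-((A s)⁻¹ * A' * (A s)⁻¹) i j) s := by
  have h1 : HasDerivAt A A' s := by
    have e : ∀ B : Matrix ι ι ℂ, B = ∑ i, ∑ j, B i j • Matrix.single i j (1 : ℂ) := by
      intro B
      conv_lhs => rw [matrix_eq_sum_single B]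
      simp
    rw [e A', funext fun r => e (A r)]
    exact HasDerivAt.fun_sum fun i _ => HasDerivAt.fun_sum fun j _ => (h i j).smul_const _
  have hu : IsUnit (A s) := (isUnit_iff_isUnit_det _).2 hA.isUnit
  obtain ⟨u, hu⟩ := hu
  have h2 := (hasFDerivAt_ringInverse (𝕜 := ℝ) u)
  rw [hu] at h2
  have h3 := h2.comp_hasDerivAt s h1
  have h4 := ((entryLinearMap ℝ ℂ i j).toContinuousLinearMap.hasFDerivAt).comp_hasDerivAt s h3
  have hui : (↑u⁻¹ : Matrix ι ι ℂ) = (A s)⁻¹ := by rw [coe_units_inv, hu]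
  simpa [Function.comp_def, nonsing_inv_eq_ringInverse, hui] using! h4

lemma hasDerivAt_bil {A : ℝ → Matrix ι ι ℂ} {A' : Matrix ι ι ℂ} {s : ℝ}
    (h : ∀ i j, HasDerivAt (fun r => A r i j) (A' i j) s) (hA : (A s).det ≠ 0)
    {y z : ℝ → ι → ℂ} {y' z' : ι → ℂ} (hy : HasDerivAt y y' s) (hz : HasDerivAt z z' s) :
    HasDerivAt (fun r => bil (A r) (y r) (z r))
      (bil (A s) y' (z s) + bil (A s) (y s) z' - sand (A s) A' (y s) (z s)) s := by
  have hy' := hasDerivAt_pi.1 hy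
  have hz' := hasDerivAt_pi.1 hz
  simp only [bil, sand, dotProduct, mulVec]
  have := HasDerivAt.fun_sum (u := Finset.univ) fun i _ => (hy' i).mul
    (HasDerivAt.fun_sum (u := Finset.univ) fun j _ =>
      (hasDerivAt_matrix_inv_apply h hA i j).mul (hz' j))
  refine this.congr_deriv ?_
  rw [← Finset.sum_add_distrib, ← Finset.sum_sub_distrib]
  refine Finset.sum_congr rfl fun i _ => ?_
  rw [add_sub_assoc, ← mul_sub, ← Finset.sum_sub_distrib]
  congr 2
  exact Finset.sum_congr rfl fun j _ => by ring

/-- Jacobi's formula: the Leibniz expansion is differentiated one column at a time, and Cramer's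
rule identifies the resulting determinants with diagonal entries of `adjugate * A'`. -/
lemma hasDerivAt_det {A : ℝ → Matrix ι ι ℂ} {A' : Matrix ι ι ℂ} {s : ℝ}
    (h : ∀ i j, HasDerivAt (fun r => A r i j) (A' i j) s) (hA : (A s).det ≠ 0) :
    HasDerivAt (fun r => (A r).det) ((A s).det * ((A s)⁻¹ * A').trace) s := by
  have h1 : HasDerivAt (fun r => (A r).det)
      (∑ i, ((A s).updateCol i (fun j => A' j i)).det) s := by
    simp only [det_apply']
    refine (HasDerivAt.fun_sum (u := (Finset.univ : Finset (Equiv.Perm ι))) fun σ _ =>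
      (HasDerivAt.fun_finsetProd (u := Finset.univ) fun i _ => h (σ i) i).const_mul
        (((Equiv.Perm.sign σ : ℤ)) : ℂ)).congr_deriv ?_
    rw [Finset.sum_comm]
    refine Finset.sum_congr rfl fun σ _ => ?_
    rw [Finset.mul_sum]
    refine Finset.sum_congr rfl fun i _ => ?_
    rw [← Finset.prod_erase_mul _ _ (Finset.mem_univ i)]
    congr 1
    rw [smul_eq_mul]
    congr 1
    · refine Finset.prod_congr rfl fun j hj => ?_
      rw [updateCol_ne (Finset.ne_of_mem_erase hj)]
    · simp
  refine h1.congr_deriv ?_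
  rw [inv_def, smul_mul, trace_smul, smul_eq_mul, ← mul_assoc, Ring.mul_inverse_cancel _ hA.isUnit,
    one_mul, trace]
  refine Finset.sum_congr rfl fun i _ => ?_
  rw [← cramer_apply, cramer_eq_adjugate_mulVec]
  simp [mul_apply, mulVec, dotProduct]

lemma trace_inv_mul_vecMulVec (A : Matrix ι ι ℂ) (u v : ι → ℂ) :
    (A⁻¹ * vecMulVec u v).trace = bil A v u := by
  rw [mul_vecMulVec, trace_vecMulVec, dotProduct_comm, bil]

end Derivatives

/-! ## The dressing at the level of matrices -/

section Dressing

variable {ι κ : Type} [Fintype ι] [DecidableEq ι] [Fintype κ]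

/-- An invertible symmetric matrix with `[diag mu, A] = -½ (a₁ a₂ᵀ - a₂ a₁ᵀ)`. -/
structure IsCauchyLike (A : Matrix ι ι ℂ) (mu a1 a2 : ι → ℂ) : Prop where
  det_ne : A.det ≠ 0
  symm : A.IsSymm
  comm : ∀ i j, (mu i - mu j) * A i j = -(1 / 2) * (a1 i * a2 j - a2 i * a1 j)

namespace IsCauchyLike

variable {A : Matrix ι ι ℂ} {mu a1 a2 : ι → ℂ} (h : IsCauchyLike A mu a1 a2)
include h

lemma mul_right (y z : ι → ℂ) :
    bil A y (mu * z) = bil A (mu * y) z - 1 / 2 * (bil A y a1 * bil A a2 z)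
      + 1 / 2 * (bil A y a2 * bil A a1 z) :=
  bil_mul_right h.det_ne h.comm y z

lemma bil_21 : bil A a2 a1 = bil A a1 a2 := bil_comm h.symm _ _

/-- Symmetry followed by one passage of `mu` through the inverse. Together with `bil_21` it fixes
one representative for mixed products, so that later identities close by `ring`. -/
lemma bil_mul_21 : bil A (mu * a2) a1 = bil A (mu * a1) a2
    - 1 / 2 * (bil A a1 a1 * bil A a2 a2) + 1 / 2 * (bil A a1 a2 * bil A a1 a2) := by
  rw [bil_comm h.symm, h.mul_right]

/-- The bracket of two dressed vectors. -/
lemma wronskian_dressed {v b : ι → ℂ} {la nu p1 p2 f1 f2 c : ℂ}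
    (hv : mu * v = la • v + (1 / 2 : ℂ) • (p1 • a2 - p2 • a1))
    (hb : mu * b = nu • b - (1 / 2 : ℂ) • (f2 • a1 - f1 • a2))
    (hc : p1 * f2 - p2 * f1 = -2 * (la - nu) * c) :
    (p1 - bil A a1 v) * (f2 - bil A a2 b) - (p2 - bil A a2 v) * (f1 - bil A a1 b)
      = -2 * (la - nu) * (c - bil A v b) := by
  -- The number `vᵀ A⁻¹ (mu * b)` is computed twice: through the relation for `mu * b`, and after
  -- moving `mu` onto `v`.
  have h1 := h.mul_right v b
  rw [hb, hv] at h1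
  simp only [bil_add_left, bil_smul_left, bil_sub_left, bil_sub_right, bil_smul_right] at h1
  rw [bil_comm h.symm v a1, bil_comm h.symm v a2] at h1
  linear_combination hc + 2 * h1

end IsCauchyLike

/-- The `x`-flow of the data `A, a₁, a₂` at the point `s`, with potentials `q, r`. -/
structure IsXFlow (A : ℝ → Matrix ι ι ℂ) (mu : ι → ℂ) (a1 a2 : ℝ → ι → ℂ) (q r : ℂ) (s : ℝ) :
    Prop where
  cauchy : IsCauchyLike (A s) mu (a1 s) (a2 s)
  gram' : ∀ i j, HasDerivAt (fun y => A y i j)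
    ((1 / 2) * (a1 s i * a2 s j + a2 s i * a1 s j)) s
  a1' : HasDerivAt a1 (-(mu * a1 s) + q • a2 s) s
  a2' : HasDerivAt a2 (r • a1 s + mu * a2 s) s

namespace IsXFlow

variable {A : ℝ → Matrix ι ι ℂ} {mu : ι → ℂ} {a1 a2 : ℝ → ι → ℂ} {q r : ℂ} {s : ℝ}
  (h : IsXFlow A mu a1 a2 q r s)
include h

lemma gram_eq (i j : ι) : HasDerivAt (fun y => A y i j)
    (((1 / 2 : ℂ) • (vecMulVec (a1 s) (a2 s) + vecMulVec (a2 s) (a1 s))) i j) s := by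
  refine (h.gram' i j).congr_deriv ?_
  simp [vecMulVec_apply]

lemma hasDerivAt_bil {y z : ℝ → ι → ℂ} {y' z' : ι → ℂ} (hy : HasDerivAt y y' s)
    (hz : HasDerivAt z z' s) :
    HasDerivAt (fun u => bil (A u) (y u) (z u))
      (bil (A s) y' (z s) + bil (A s) (y s) z'
        - 1 / 2 * (bil (A s) (y s) (a1 s) * bil (A s) (a2 s) (z s)
          + bil (A s) (y s) (a2 s) * bil (A s) (a1 s) (z s))) s := by
  refine (NLSESCS.hasDerivAt_bil h.gram_eq h.cauchy.det_ne hy hz).congr_deriv ?_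
  rw [sand_smul, sand_add, sand_vecMulVec, sand_vecMulVec]

lemma hasDerivAt_det : HasDerivAt (fun y => (A y).det)
    ((A s).det * bil (A s) (a1 s) (a2 s)) s := by
  refine (NLSESCS.hasDerivAt_det h.gram_eq h.cauchy.det_ne).congr_deriv ?_
  rw [Matrix.mul_smul, trace_smul, mul_add, trace_add, trace_inv_mul_vecMulVec,
    trace_inv_mul_vecMulVec, h.cauchy.bil_21, smul_eq_mul]
  ring

lemma hasDerivAt_bil_11 : HasDerivAt (fun y => bil (A y) (a1 y) (a1 y))
    (2 * q * bil (A s) (a1 s) (a2 s) - bil (A s) (a1 s) (a1 s) * bil (A s) (a1 s) (a2 s)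
      - 2 * bil (A s) (mu * a1 s) (a1 s)) s := by
  refine (h.hasDerivAt_bil h.a1' h.a1').congr_deriv ?_
  simp only [bil_add_left, bil_add_right, bil_neg_left, bil_neg_right, bil_smul_left,
    bil_smul_right, h.cauchy.mul_right, h.cauchy.bil_21]
  ring

lemma hasDerivAt_bil_22 : HasDerivAt (fun y => bil (A y) (a2 y) (a2 y))
    (2 * r * bil (A s) (a1 s) (a2 s) - bil (A s) (a1 s) (a2 s) * bil (A s) (a2 s) (a2 s)
      + 2 * bil (A s) (mu * a2 s) (a2 s)) s := by
  refine (h.hasDerivAt_bil h.a2' h.a2').congr_deriv ?_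
  simp only [bil_add_left, bil_add_right, bil_smul_left,
    bil_smul_right, h.cauchy.mul_right, h.cauchy.bil_21]
  ring

/-- The terms with `mu` cancel. The value is `q r - (q - bil a₁ a₁)(r - bil a₂ a₂)`, the change in
the product of the potentials, which is the source of the formula for `|q̄|²`. -/
lemma hasDerivAt_bil_12 : HasDerivAt (fun y => bil (A y) (a1 y) (a2 y))
    (q * bil (A s) (a2 s) (a2 s) + r * bil (A s) (a1 s) (a1 s)
      - bil (A s) (a1 s) (a1 s) * bil (A s) (a2 s) (a2 s)) s := by
  refine (h.hasDerivAt_bil h.a1' h.a2').congr_deriv ?_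
  simp only [bil_add_left, bil_add_right, bil_neg_left, bil_smul_left,
    bil_smul_right, h.cauchy.mul_right]
  ring

/-- This moment occurs in the first `x`-derivative of `bil a₁ a₁`, so its own derivative is needed
for the second `x`-derivative of the new potential. -/
lemma hasDerivAt_bil_mul_11 : HasDerivAt (fun y => bil (A y) (mu * a1 y) (a1 y))
    (-2 * bil (A s) (mu * (mu * a1 s)) (a1 s) + 2 * q * bil (A s) (mu * a1 s) (a2 s)
      - q / 2 * (bil (A s) (a1 s) (a1 s) * bil (A s) (a2 s) (a2 s))
      + q / 2 * (bil (A s) (a1 s) (a2 s) * bil (A s) (a1 s) (a2 s))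
      - bil (A s) (mu * a1 s) (a2 s) * bil (A s) (a1 s) (a1 s)) s := by
  refine (h.hasDerivAt_bil (h.a1'.const_mul mu) h.a1').congr_deriv ?_
  simp only [mul_add, mul_neg, mul_smul_comm, bil_add_left, bil_add_right, bil_neg_left,
    bil_neg_right, bil_smul_left, bil_smul_right, h.cauchy.mul_right, h.cauchy.bil_21,
    h.cauchy.bil_mul_21]
  ring

/-- A dressed solution of the spectral problem. -/
lemma hasDerivAt_dressed {b : ℝ → ι → ℂ} {f1 f2 : ℝ → ℂ} {nu : ℂ}
    (hb : HasDerivAt b ((1 / 2 : ℂ) • (f2 s • a1 s + f1 s • a2 s)) s)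
    (hmu : mu * b s = nu • b s - (1 / 2 : ℂ) • (f2 s • a1 s - f1 s • a2 s))
    (hf1 : HasDerivAt f1 (-nu * f1 s + q * f2 s) s)
    (hf2 : HasDerivAt f2 (r * f1 s + nu * f2 s) s) :
    HasDerivAt (fun y => f1 y - bil (A y) (a1 y) (b y))
        (-nu * (f1 s - bil (A s) (a1 s) (b s))
          + (q - bil (A s) (a1 s) (a1 s)) * (f2 s - bil (A s) (a2 s) (b s))) s ∧
      HasDerivAt (fun y => f2 y - bil (A y) (a2 y) (b y))
        ((r - bil (A s) (a2 s) (a2 s)) * (f1 s - bil (A s) (a1 s) (b s))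
          + nu * (f2 s - bil (A s) (a2 s) (b s))) s := by
  -- Comparing these two evaluations of `aₖᵀ A⁻¹ (mu * b)` trades the parameters inside `mu * aₖ`
  -- for the single parameter `nu`.
  have k1 := h.cauchy.mul_right (a1 s) (b s)
  have k2 := h.cauchy.mul_right (a2 s) (b s)
  rw [hmu] at k1 k2
  simp only [bil_sub_right, bil_smul_right, h.cauchy.bil_21] at k1 k2
  constructor
  · refine (hf1.sub (h.hasDerivAt_bil h.a1' hb)).congr_deriv ?_
    simp only [bil_add_left, bil_add_right, bil_neg_left, bil_smul_left, bil_smul_right]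
    linear_combination -k1
  · refine (hf2.sub (h.hasDerivAt_bil h.a2' hb)).congr_deriv ?_
    simp only [bil_add_left, bil_add_right, bil_smul_left, bil_smul_right, h.cauchy.bil_21]
    linear_combination k2

end IsXFlow

/-- The `t`-flow of the data `A, a₁, a₂` at the point `s`, with potentials `q, r`, their
`x`-derivatives `qx, rx`, and sources `(p₁ₖ, p₂ₖ)` at `la k` with brackets `v k`. -/
structure IsTFlow (A : ℝ → Matrix ι ι ℂ) (mu : ι → ℂ) (a1 a2 : ℝ → ι → ℂ) (q r qx rx : ℂ)
    (la p1 p2 : κ → ℂ) (v : κ → ι → ℂ) (s : ℝ) : Prop where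
  cauchy : IsCauchyLike (A s) mu (a1 s) (a2 s)
  gram' : ∀ i j, HasDerivAt (fun y => A y i j)
    (Complex.I * ((mu i + mu j) * (a1 s i * a2 s j + a2 s i * a1 s j)
      + r * (a1 s i * a1 s j) - q * (a2 s i * a2 s j)) + ∑ k, v k i * v k j) s
  a1' : HasDerivAt a1 (Complex.I • ((-2 : ℂ) • (mu * (mu * a1 s)) + (2 * q) • (mu * a2 s)
    + (q * r) • a1 s - qx • a2 s) + ∑ k, p1 k • v k) s
  a2' : HasDerivAt a2 (Complex.I • ((2 : ℂ) • (mu * (mu * a2 s)) + (2 * r) • (mu * a1 s)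
    + rx • a1 s - (q * r) • a2 s) + ∑ k, p2 k • v k) s
  source : ∀ k, mu * v k = la k • v k + (1 / 2 : ℂ) • (p1 k • a2 s - p2 k • a1 s)

namespace IsTFlow

variable {A : ℝ → Matrix ι ι ℂ} {mu : ι → ℂ} {a1 a2 : ℝ → ι → ℂ} {q r qx rx : ℂ}
  {la p1 p2 : κ → ℂ} {v : κ → ι → ℂ} {s : ℝ}
  (h : IsTFlow A mu a1 a2 q r qx rx la p1 p2 v s)
include h

lemma gram_eq (i j : ι) : HasDerivAt (fun y => A y i j)
    ((Complex.I • (vecMulVec (mu * a1 s) (a2 s) + vecMulVec (mu * a2 s) (a1 s)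
      + vecMulVec (a1 s) (mu * a2 s) + vecMulVec (a2 s) (mu * a1 s)
      + r • vecMulVec (a1 s) (a1 s) - q • vecMulVec (a2 s) (a2 s))
      + ∑ k, vecMulVec (v k) (v k)) i j) s := by
  refine (h.gram' i j).congr_deriv ?_
  simp only [Matrix.add_apply, Matrix.sub_apply, Matrix.smul_apply, Matrix.sum_apply,
    vecMulVec_apply, Pi.mul_apply, smul_eq_mul]
  ring

lemma hasDerivAt_bil {y z : ℝ → ι → ℂ} {y' z' : ι → ℂ} (hy : HasDerivAt y y' s)
    (hz : HasDerivAt z z' s) :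
    HasDerivAt (fun u => bil (A u) (y u) (z u))
      (bil (A s) y' (z s) + bil (A s) (y s) z'
        - Complex.I * (bil (A s) (y s) (mu * a1 s) * bil (A s) (a2 s) (z s)
          + bil (A s) (y s) (mu * a2 s) * bil (A s) (a1 s) (z s)
          + bil (A s) (y s) (a1 s) * bil (A s) (mu * a2 s) (z s)
          + bil (A s) (y s) (a2 s) * bil (A s) (mu * a1 s) (z s)
          + r * (bil (A s) (y s) (a1 s) * bil (A s) (a1 s) (z s))
          - q * (bil (A s) (y s) (a2 s) * bil (A s) (a2 s) (z s)))
        - ∑ k, bil (A s) (y s) (v k) * bil (A s) (v k) (z s)) s := by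
  refine (NLSESCS.hasDerivAt_bil h.gram_eq h.cauchy.det_ne hy hz).congr_deriv ?_
  simp only [sand_smul, sand_add, sand_sub, sand_vecMulVec, sand_sum]
  ring

/-- The value is left as the right side of the equation for `q` minus that for the dressed
potential, with the second `x`-derivative of `bil a₁ a₁` written out; subtraction from `q_t` then
gives the new equation. The number `qxx` cancels and is arbitrary. The source terms complete the
squares `(p₁ - bil a₁ v)²`. -/
lemma hasDerivAt_bil_11 {qxx : ℂ} : HasDerivAt (fun y => bil (A y) (a1 y) (a1 y))
    (Complex.I * (2 * (q * r * q) - qxx)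
      - Complex.I * (2 * ((q - bil (A s) (a1 s) (a1 s)) * (r - bil (A s) (a2 s) (a2 s))
          * (q - bil (A s) (a1 s) (a1 s)))
        - (qxx - (2 * (qx * bil (A s) (a1 s) (a2 s)
            + q * (q * bil (A s) (a2 s) (a2 s) + r * bil (A s) (a1 s) (a1 s)
              - bil (A s) (a1 s) (a1 s) * bil (A s) (a2 s) (a2 s)))
          - ((2 * q * bil (A s) (a1 s) (a2 s)
              - bil (A s) (a1 s) (a1 s) * bil (A s) (a1 s) (a2 s)
              - 2 * bil (A s) (mu * a1 s) (a1 s)) * bil (A s) (a1 s) (a2 s)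
            + bil (A s) (a1 s) (a1 s)
              * (q * bil (A s) (a2 s) (a2 s) + r * bil (A s) (a1 s) (a1 s)
              - bil (A s) (a1 s) (a1 s) * bil (A s) (a2 s) (a2 s)))
          - 2 * (-2 * bil (A s) (mu * (mu * a1 s)) (a1 s)
            + 2 * q * bil (A s) (mu * a1 s) (a2 s)
            - q / 2 * (bil (A s) (a1 s) (a1 s) * bil (A s) (a2 s) (a2 s))
            + q / 2 * (bil (A s) (a1 s) (a2 s) * bil (A s) (a1 s) (a2 s))
            - bil (A s) (mu * a1 s) (a2 s) * bil (A s) (a1 s) (a1 s)))))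
      + ∑ k, p1 k ^ 2 - ∑ k, (p1 k - bil (A s) (a1 s) (v k)) ^ 2) s := by
  refine (h.hasDerivAt_bil h.a1' h.a1').congr_deriv ?_
  simp only [bil_add_left, bil_add_right, bil_sub_left, bil_sub_right,
    bil_smul_left, bil_smul_right, bil_sum_left, bil_sum_right, h.cauchy.mul_right,
    h.cauchy.bil_21, h.cauchy.bil_mul_21, bil_comm h.cauchy.symm (v _) (a1 s)]
  have e : ∑ k, (p1 k - bil (A s) (a1 s) (v k)) ^ 2 = ∑ k, p1 k ^ 2
      - 2 * ∑ k, p1 k * bil (A s) (a1 s) (v k)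
      + ∑ k, bil (A s) (a1 s) (v k) * bil (A s) (a1 s) (v k) := by
    rw [Finset.mul_sum, ← Finset.sum_sub_distrib, ← Finset.sum_add_distrib]
    exact Finset.sum_congr rfl fun k _ => by ring
  rw [e]
  ring

/-- A dressed solution of the `t`-part of the Lax pair. -/
lemma hasDerivAt_dressed {b : ℝ → ι → ℂ} {f1 f2 : ℝ → ℂ} {nu : ℂ} {c : κ → ℂ}
    (hb : HasDerivAt b (Complex.I • ((f2 s • (mu * a1 s) + f1 s • (mu * a2 s))
      + nu • (f2 s • a1 s + f1 s • a2 s) + (r * f1 s) • a1 s - (q * f2 s) • a2 s)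
      + ∑ k, c k • v k) s)
    (hmu : mu * b s = nu • b s - (1 / 2 : ℂ) • (f2 s • a1 s - f1 s • a2 s))
    (hf1 : HasDerivAt f1 (Complex.I * ((-2 * nu ^ 2 + q * r) * f1 s + (2 * nu * q - qx) * f2 s)
      + ∑ k, c k * p1 k) s)
    (hf2 : HasDerivAt f2 (Complex.I * ((2 * nu * r + rx) * f1 s + (2 * nu ^ 2 - q * r) * f2 s)
      + ∑ k, c k * p2 k) s) :
    HasDerivAt (fun y => f1 y - bil (A y) (a1 y) (b y))
        (Complex.I * ((-2 * nu ^ 2 + (q - bil (A s) (a1 s) (a1 s))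
              * (r - bil (A s) (a2 s) (a2 s))) * (f1 s - bil (A s) (a1 s) (b s))
            + (2 * nu * (q - bil (A s) (a1 s) (a1 s))
              - (qx - (2 * q * bil (A s) (a1 s) (a2 s)
                - bil (A s) (a1 s) (a1 s) * bil (A s) (a1 s) (a2 s)
                - 2 * bil (A s) (mu * a1 s) (a1 s)))) * (f2 s - bil (A s) (a2 s) (b s)))
          + ∑ k, (c k - bil (A s) (v k) (b s)) * (p1 k - bil (A s) (a1 s) (v k))) s ∧
      HasDerivAt (fun y => f2 y - bil (A y) (a2 y) (b y))
        (Complex.I * ((2 * nu * (r - bil (A s) (a2 s) (a2 s))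
              + (rx - (2 * r * bil (A s) (a1 s) (a2 s)
                - bil (A s) (a1 s) (a2 s) * bil (A s) (a2 s) (a2 s)
                + 2 * bil (A s) (mu * a2 s) (a2 s)))) * (f1 s - bil (A s) (a1 s) (b s))
            + (2 * nu ^ 2 - (q - bil (A s) (a1 s) (a1 s))
              * (r - bil (A s) (a2 s) (a2 s))) * (f2 s - bil (A s) (a2 s) (b s)))
          + ∑ k, (c k - bil (A s) (v k) (b s)) * (p2 k - bil (A s) (a2 s) (v k))) s := by
  have hc := h.cauchy
  have k1 := hc.mul_right (a1 s) (b s)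
  have k2 := hc.mul_right (a2 s) (b s)
  -- `V` is quadratic in the parameter, so the relation is also needed with a second factor `mu`.
  have k3 := hc.mul_right (mu * a1 s) (b s)
  have k4 := hc.mul_right (mu * a2 s) (b s)
  rw [hmu] at k1 k2 k3 k4
  simp only [bil_sub_right, bil_smul_right, hc.bil_21, hc.bil_mul_21] at k1 k2 k3 k4
  have e : ∀ (a : ι → ℂ) (p : κ → ℂ),
      ∑ k, (c k - bil (A s) (v k) (b s)) * (p k - bil (A s) a (v k))
      = ∑ k, c k * p k - ∑ k, p k * bil (A s) (v k) (b s) - ∑ k, c k * bil (A s) a (v k)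
      + ∑ k, bil (A s) a (v k) * bil (A s) (v k) (b s) := by
    intro a p
    rw [← Finset.sum_sub_distrib, ← Finset.sum_sub_distrib, ← Finset.sum_add_distrib]
    exact Finset.sum_congr rfl fun k _ => by ring
  have m1 : bil (A s) (mu * a1 s) (b s) = nu * bil (A s) (a1 s) (b s)
      - 1 / 2 * (f2 s * bil (A s) (a1 s) (a1 s) - f1 s * bil (A s) (a1 s) (a2 s))
      + 1 / 2 * (bil (A s) (a1 s) (a1 s) * bil (A s) (a2 s) (b s))
      - 1 / 2 * (bil (A s) (a1 s) (a2 s) * bil (A s) (a1 s) (b s)) := by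
    linear_combination -k1
  have m2 : bil (A s) (mu * a2 s) (b s) = nu * bil (A s) (a2 s) (b s)
      - 1 / 2 * (f2 s * bil (A s) (a1 s) (a2 s) - f1 s * bil (A s) (a2 s) (a2 s))
      + 1 / 2 * (bil (A s) (a1 s) (a2 s) * bil (A s) (a2 s) (b s))
      - 1 / 2 * (bil (A s) (a2 s) (a2 s) * bil (A s) (a1 s) (b s)) := by
    linear_combination -k2
  constructor
  · refine (hf1.sub (h.hasDerivAt_bil h.a1' hb)).congr_deriv ?_
    rw [e]
    simp only [bil_add_left, bil_add_right, bil_sub_left, bil_sub_right,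
      bil_smul_left, bil_smul_right, bil_sum_left, bil_sum_right, hc.mul_right,
      hc.bil_21, m1, m2] at k3 ⊢
    linear_combination (-2 * Complex.I) * k3
  · refine (hf2.sub (h.hasDerivAt_bil h.a2' hb)).congr_deriv ?_
    rw [e]
    simp only [bil_add_left, bil_add_right, bil_sub_left, bil_sub_right,
      bil_smul_left, bil_smul_right, bil_sum_left, bil_sum_right, hc.mul_right,
      hc.bil_21, hc.bil_mul_21, m1, m2] at k4 ⊢
    linear_combination (2 * Complex.I) * k4

end IsTFlow

end Dressing

/-! ## Differentiation in the spectral parameter -/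

section MixedDerivative

variable {E : Type*} [NormedAddCommGroup E] [NormedSpace ℂ E] [CompleteSpace E]

/-- A holomorphic parameter derivative commutes with a real derivative. -/
lemma hasDerivAt_deriv_of_continuousOn {U : Set ℂ} (hU : IsOpen U) {J : Set ℝ} (hJ : IsOpen J)
    {F G : ℂ → ℝ → E} (hF : ∀ s ∈ J, DifferentiableOn ℂ (fun mu => F mu s) U)
    (hFG : ∀ mu ∈ U, ∀ s ∈ J, HasDerivAt (F mu) (G mu s) s)
    (hG : ContinuousOn (fun z : ℂ × ℝ => G z.1 z.2) (U ×ˢ J)) {mu : ℂ} (hmu : mu ∈ U) {s : ℝ}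
    (hs : s ∈ J) (hGs : DifferentiableOn ℂ (fun nu => G nu s) U) :
    HasDerivAt (fun r => deriv (fun nu => F nu r) mu) (deriv (fun nu => G nu s) mu) s := by
  obtain ⟨r, hr, hrU⟩ := Metric.nhds_basis_closedBall.mem_iff.1 (hU.mem_nhds hmu)
  obtain ⟨e, he, heJ⟩ := Metric.nhds_basis_closedBall.mem_iff.1 (hJ.mem_nhds hs)
  have hcm : ∀ θ, circleMap mu r θ ∈ U := fun θ =>
    hrU (Metric.sphere_subset_closedBall (circleMap_mem_sphere _ hr.le _))
  have hne : ∀ θ, (circleMap mu r θ - mu) ^ 2 ≠ 0 := fun θ =>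
    pow_ne_zero 2 (sub_ne_zero.2 (circleMap_ne_center hr.ne'))
  -- Kernel of Cauchy's formula for the first derivative, pulled back to the angle; the real
  -- derivative is then taken under the integral sign.
  let k : ℝ → ℂ := fun θ => deriv (circleMap mu r) θ * ((circleMap mu r θ - mu) ^ 2)⁻¹
  have hk : Continuous k := by
    have : Continuous fun θ => deriv (circleMap mu r) θ := by
      simp only [deriv_circleMap]
      exact (continuous_circleMap 0 r).mul continuous_const
    exact this.mul ((((continuous_circleMap mu r).sub continuous_const).pow 2).inv₀ hne)
  have hFc : ∀ u ∈ J, Continuous fun θ => k θ • F (circleMap mu r θ) u := fun u hu =>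
    hk.smul ((hF u hu).continuousOn.comp_continuous (continuous_circleMap mu r) hcm)
  have hGc : ContinuousOn (fun z : ℝ × ℝ => k z.1 • G (circleMap mu r z.1) z.2)
      (Set.univ ×ˢ J) := by
    refine (hk.comp continuous_fst).continuousOn.smul (hG.comp
      (((continuous_circleMap mu r).comp continuous_fst).prodMk continuous_snd).continuousOn ?_)
    exact fun z hz => ⟨hcm _, hz.2⟩
  have hGs' : Continuous fun θ => k θ • G (circleMap mu r θ) s :=
    hGc.comp_continuous (continuous_id.prodMk continuous_const) fun θ => ⟨trivial, hs⟩
  -- Joint continuity on the compact set of angles and nearby times gives a constant as dominating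
  -- function.
  obtain ⟨C, hC⟩ := (isCompact_uIcc.prod (isCompact_closedBall s e)).exists_bound_of_continuousOn
    (hGc.mono (Set.prod_mono (Set.subset_univ (Set.uIcc 0 (2 * Real.pi))) heJ))
  have key := (intervalIntegral.hasDerivAt_integral_of_dominated_loc_of_deriv_le
    (μ := MeasureTheory.volume) (a := 0) (b := 2 * Real.pi)
    (F := fun u θ => k θ • F (circleMap mu r θ) u)
    (F' := fun u θ => k θ • G (circleMap mu r θ) u) (bound := fun _ => C)
    (Metric.closedBall_mem_nhds s he)
    (Filter.eventually_of_mem (hJ.mem_nhds hs) fun u hu => (hFc u hu).aestronglyMeasurable)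
    ((hFc s hs).intervalIntegrable _ _) hGs'.aestronglyMeasurable
    (.of_forall fun θ hθ u hu => hC (θ, u) ⟨Set.uIoc_subset_uIcc hθ, hu⟩)
    intervalIntegrable_const
    (.of_forall fun θ _ u hu => (hFG _ (hcm θ) u (heJ hu)).const_smul (k θ))).2
  have hcd : ∀ f : ℂ → E, Complex.cderiv r f mu
      = (2 * Real.pi * Complex.I : ℂ)⁻¹ • ∫ θ in (0 : ℝ)..2 * Real.pi,
        k θ • f (circleMap mu r θ) := by
    intro f
    simp only [Complex.cderiv, circleIntegral, k, mul_smul]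
  have key2 := key.const_smul (2 * Real.pi * Complex.I : ℂ)⁻¹
  rw [← hcd (fun nu => G nu s), Complex.cderiv_eq_deriv hU hGs hr hrU] at key2
  refine key2.congr_of_eventuallyEq (Filter.eventually_of_mem (hJ.mem_nhds hs) fun u hu => ?_)
  change deriv (fun nu => F nu u) mu = (2 * Real.pi * Complex.I : ℂ)⁻¹ •
    ∫ θ in (0 : ℝ)..2 * Real.pi, k θ • F (circleMap mu r θ) u
  rw [← hcd (fun nu => F nu u), Complex.cderiv_eq_deriv hU (hF u hu) hr hrU]

/-- The `C¹` hypothesis supplies the joint continuity that differentiation under the integral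
requires: `G` coincides with the total derivative in the direction `(0, e)`. The curve `l` is used
for the two coordinate lines. -/
lemma hasDerivAt_deriv_of_contDiffOn {O : Set ℂ} (hO : IsOpen O) {Ω : Set (ℝ × ℝ)}
    (hΩ : IsOpen Ω) {F : ℂ → ℝ × ℝ → E}
    (hC : ContDiffOn ℝ 1 (fun z : ℂ × (ℝ × ℝ) => F z.1 z.2) (O ×ˢ Ω))
    (hF : ∀ p ∈ Ω, DifferentiableOn ℂ (fun mu => F mu p) O)
    {l : ℝ → ℝ × ℝ} {e : ℝ × ℝ} (hl : ∀ s, HasDerivAt l e s) {G : ℂ → ℝ → E}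
    (hG : ∀ mu ∈ O, ∀ s, l s ∈ Ω → HasDerivAt (fun r => F mu (l r)) (G mu s) s)
    {mu : ℂ} (hmu : mu ∈ O) {s : ℝ} (hs : l s ∈ Ω) (hGs : DifferentiableOn ℂ (fun nu => G nu s) O) :
    HasDerivAt (fun r => deriv (fun nu => F nu (l r)) mu) (deriv (fun nu => G nu s) mu) s := by
  have hlc : Continuous l := continuous_iff_continuousAt.2 fun s => (hl s).continuousAt
  refine hasDerivAt_deriv_of_continuousOn hO (hΩ.preimage hlc) (F := fun mu s => F mu (l s))
    (fun s hs => hF _ hs) hG ?_ hmu hs hGs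
  have hop := hO.prod hΩ
  have h1 : ContinuousOn (fun z : ℂ × ℝ =>
      fderiv ℝ (fun z : ℂ × (ℝ × ℝ) => F z.1 z.2) (z.1, l z.2) (0, e)) (O ×ˢ (l ⁻¹' Ω)) := by
    refine ContinuousOn.clm_apply ?_ continuousOn_const
    refine (hC.continuousOn_fderiv_of_isOpen hop le_rfl).comp
      (continuous_fst.prodMk (hlc.comp continuous_snd)).continuousOn fun z hz => hz
  refine h1.congr fun z hz => ?_
  have hd := (hC.contDiffAt (hop.mem_nhds (show (z.1, l z.2) ∈ O ×ˢ Ω from hz))).differentiableAt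
    one_ne_zero
  have h2 := hd.hasFDerivAt.comp_hasDerivAt z.2 ((hasDerivAt_const z.2 z.1).prodMk (hl z.2))
  exact (hG z.1 hz.1 z.2 hz.2).unique h2

end MixedDerivative

/-! ## The Lax pair in components -/

section Components

variable {m n : ℕ} {lam : Fin m → ℂ} {zeta : Fin n → ℂ}
    {q : ℝ → ℝ → ℂ} {phi : Fin m → ℝ → ℝ → Fin 2 → ℂ} {w : Fin n → ℝ → ℝ → ℂ}

/-- The source vectors, in the order of `poles`. -/
def sources (phi : Fin m → ℝ → ℝ → Fin 2 → ℂ) (w : Fin n → ℝ → ℝ → ℂ) (x t : ℝ) :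
    (Fin m ⊕ Fin m) ⊕ Fin n → Fin 2 → ℂ :=
  Sum.elim (Sum.elim (fun j => phi j x t) (fun j => sPlus (phi j x t)))
    (fun j => realVec (w j x t))

/-- Puts all poles on an equal footing, so that one sum replaces the three kinds of source terms. -/
lemma laxR_eq (mu : ℂ) (x t : ℝ) : laxR lam zeta q phi w mu x t
    = laxV mu q (fun y s => conj (q y s)) x t
      + ∑ k, (mu - poles lam zeta k)⁻¹ • sourceH (sources phi w x t k) := by
  simp [laxR, poles, sources, Finset.sum_add_distrib, add_assoc]

/-- The bracket of a source `p` at `la` with a vector `f` at `mu`. -/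
def bracket (la : ℂ) (p : Fin 2 → ℂ) (mu : ℂ) (f : Fin 2 → ℂ) : ℂ :=
  wronskian p f / (2 * (mu - la))

/-- `H(p)` has rank at most one: `H(p) f = ½ W(p, f) p`. Each pole therefore acts by adding a
bracket times its source vector. -/
lemma smul_sourceH_mulVec (la mu : ℂ) (p f : Fin 2 → ℂ) :
    ((mu - la)⁻¹ • sourceH p) *ᵥ f = bracket la p mu f • p := by
  ext k
  fin_cases k <;> simp [sourceH, bracket, wronskian, mulVec, dotProduct, Fin.sum_univ_two, div_eq_mul_inv] <;> ring

lemma laxU_mulVec_zero (mu q r : ℂ) (f : Fin 2 → ℂ) :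
    (laxU mu q r *ᵥ f) 0 = -mu * f 0 + q * f 1 := by
  simp [laxU, mulVec, dotProduct, Fin.sum_univ_two]

lemma laxU_mulVec_one (mu q r : ℂ) (f : Fin 2 → ℂ) :
    (laxU mu q r *ᵥ f) 1 = r * f 0 + mu * f 1 := by
  simp [laxU, mulVec, dotProduct, Fin.sum_univ_two]

lemma laxR_mulVec (mu : ℂ) (x t : ℝ) (f : Fin 2 → ℂ) :
    laxR lam zeta q phi w mu x t *ᵥ f = laxV mu q (fun y s => conj (q y s)) x t *ᵥ f
      + ∑ k, bracket (poles lam zeta k) (sources phi w x t k) mu f • sources phi w x t k := by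
  simp only [laxR_eq, add_mulVec, sum_mulVec, smul_sourceH_mulVec]

lemma laxR_mulVec_zero (mu : ℂ) (x t : ℝ) (f : Fin 2 → ℂ) :
    (laxR lam zeta q phi w mu x t *ᵥ f) 0
      = Complex.I * ((-2 * mu ^ 2 + q x t * conj (q x t)) * f 0
        + (2 * mu * q x t - deriv (fun y => q y t) x) * f 1)
      + ∑ k, bracket (poles lam zeta k) (sources phi w x t k) mu f
        * sources phi w x t k 0 := by
  rw [laxR_mulVec]
  simp [laxV, dotProduct, Fin.sum_univ_two]
  ring

lemma laxR_mulVec_one (mu : ℂ) (x t : ℝ) (f : Fin 2 → ℂ) :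
    (laxR lam zeta q phi w mu x t *ᵥ f) 1
      = Complex.I * ((2 * mu * conj (q x t) + deriv (fun y => conj (q y t)) x) * f 0
        + (2 * mu ^ 2 - q x t * conj (q x t)) * f 1)
      + ∑ k, bracket (poles lam zeta k) (sources phi w x t k) mu f
        * sources phi w x t k 1 := by
  rw [laxR_mulVec]
  simp [laxV, dotProduct, Fin.sum_univ_two]
  ring

lemma hasDerivAt_fin_two {f : ℝ → Fin 2 → ℂ} {f' : Fin 2 → ℂ} {s : ℝ} :
    HasDerivAt f f' s ↔
      HasDerivAt (fun r => f r 0) (f' 0) s ∧ HasDerivAt (fun r => f r 1) (f' 1) s := by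
  rw [hasDerivAt_pi, Fin.forall_fin_two]

end Components

/-! ## Derivatives of the bracket `σ` -/

section SigmaDerivatives

variable {m n : ℕ} {lam : Fin m → ℂ} {zeta : Fin n → ℂ}
    {q : ℝ → ℝ → ℂ} {phi : Fin m → ℝ → ℝ → Fin 2 → ℂ} {w : Fin n → ℝ → ℝ → ℂ}
    {D : Set (ℝ × ℝ)}

/-- At equal parameters `sigma` differentiates only its second argument, so symmetry there requires
equal families. -/
lemma sigma_symm (F G : SpectralFamily) (h : F.param = G.param → F = G) (x t : ℝ) :
    sigma F G x t = sigma G F x t := by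
  by_cases hp : F.param = G.param
  · rw [h hp]
  · rw [sigma, sigma, if_neg hp, if_neg (Ne.symm hp), ← neg_sub, mul_neg, div_neg, ← neg_div,
      neg_neg]
    congr 1
    simp only [wronskian]
    ring

lemma sigma_comm_relation (F G : SpectralFamily) (h : F.param ≠ G.param) (x t : ℝ) :
    (F.param - G.param) * sigma F G x t
      = -(1 / 2) * (F.val x t 0 * G.val x t 1 - F.val x t 1 * G.val x t 0) := by
  have := sub_ne_zero.2 h
  rw [sigma, if_neg h, wronskian]
  field_simp

/-- In the derivative of the Wronskian the potentials cancel, and what remains is divisible by the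
difference of the parameters, which removes the denominator. -/
lemma hasDerivAt_sigma_x {F G : SpectralFamily} (hFG : F.param ≠ G.param) {u v : ℂ} {x t : ℝ}
    (hF : HasDerivAt (fun y => F.val y t) (laxU F.param u v *ᵥ F.val x t) x)
    (hG : HasDerivAt (fun y => G.val y t) (laxU G.param u v *ᵥ G.val x t) x) :
    HasDerivAt (fun y => sigma F G y t)
      (1 / 2 * (F.val x t 0 * G.val x t 1 + F.val x t 1 * G.val x t 0)) x := by
  have hne := sub_ne_zero.2 hFG
  obtain ⟨f0, f1⟩ := hasDerivAt_fin_two.1 hF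
  obtain ⟨g0, g1⟩ := hasDerivAt_fin_two.1 hG
  rw [laxU_mulVec_zero] at f0 g0
  rw [laxU_mulVec_one] at f1 g1
  simp only [sigma, if_neg hFG, wronskian]
  refine (((f0.mul g1).sub (f1.mul g0)).neg.div_const _).congr_deriv ?_
  field_simp
  ring

lemma two_mul_bracket {la mu : ℂ} (h : mu ≠ la) (p f : Fin 2 → ℂ) :
    p 0 * f 1 - p 1 * f 0 = 2 * (mu - la) * bracket la p mu f := by
  have := sub_ne_zero.2 h
  rw [bracket, wronskian]
  field_simp

lemma hasDerivAt_sigma_t {F G : SpectralFamily} (hFG : F.param ≠ G.param)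
    (hF : IsLaxSolution D lam zeta q phi w F.param F.val)
    (hG : IsLaxSolution D lam zeta q phi w G.param G.val)
    (hFp : F.param ∉ Set.range (poles lam zeta)) (hGp : G.param ∉ Set.range (poles lam zeta))
    {x t : ℝ} (hx : (x, t) ∈ D) :
    HasDerivAt (fun s => sigma F G x s)
      (Complex.I * ((F.param + G.param) * (F.val x t 0 * G.val x t 1 + F.val x t 1 * G.val x t 0)
        + conj (q x t) * (F.val x t 0 * G.val x t 0) - q x t * (F.val x t 1 * G.val x t 1))
      + ∑ k, bracket (poles lam zeta k) (sources phi w x t k) F.param (F.val x t)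
        * bracket (poles lam zeta k) (sources phi w x t k) G.param (G.val x t)) t := by
  have hne := sub_ne_zero.2 hFG
  obtain ⟨f0, f1⟩ := hasDerivAt_fin_two.1 (hF.psi_t x t hx)
  obtain ⟨g0, g1⟩ := hasDerivAt_fin_two.1 (hG.psi_t x t hx)
  rw [laxR_mulVec_zero] at f0 g0
  rw [laxR_mulVec_one] at f1 g1
  simp only [sigma, if_neg hFG, wronskian]
  refine (((f0.mul g1).sub (f1.mul g0)).neg.div_const _).congr_deriv ?_
  rw [div_eq_iff (mul_ne_zero two_ne_zero hne)]
  set p := sources phi w x t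
  set l := poles lam zeta
  -- The partial-fraction step: the difference of parameters is written as the difference of their
  -- distances to the pole, each of which turns one bracket back into a Wronskian.
  have e : ∀ k, bracket (l k) (p k) F.param (F.val x t) * bracket (l k) (p k) G.param (G.val x t)
      * (2 * (F.param - G.param))
      = -(bracket (l k) (p k) F.param (F.val x t) * p k 0 * G.val x t 1)
        + bracket (l k) (p k) F.param (F.val x t) * p k 1 * G.val x t 0
        + bracket (l k) (p k) G.param (G.val x t) * p k 0 * F.val x t 1
        - bracket (l k) (p k) G.param (G.val x t) * p k 1 * F.val x t 0 := by
    intro k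
    have h1 := two_mul_bracket (fun e => hFp ⟨k, e.symm⟩) (p k) (F.val x t)
    have h2 := two_mul_bracket (fun e => hGp ⟨k, e.symm⟩) (p k) (G.val x t)
    linear_combination bracket (l k) (p k) F.param (F.val x t) * h2
      - bracket (l k) (p k) G.param (G.val x t) * h1
  have hs := Finset.sum_congr rfl fun k (_ : k ∈ Finset.univ) => e k
  simp only [Finset.sum_sub_distrib, Finset.sum_add_distrib, Finset.sum_neg_distrib,
    ← Finset.sum_mul] at hs
  linear_combination -hs

lemma IsLaxFamily.isLaxSolution {F : SpectralFamily} (hF : IsLaxFamily D lam zeta q phi w F) :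
    IsLaxSolution D lam zeta q phi w F.param F.val := by
  obtain ⟨O, -, h, -, -, h'⟩ := hF
  exact h' _ h

lemma hasDerivAt_prodMk_left (t s : ℝ) : HasDerivAt (fun y : ℝ => (y, t)) (1, 0) s :=
  (hasDerivAt_id s).prodMk (hasDerivAt_const s t)

lemma hasDerivAt_prodMk_right (x s : ℝ) : HasDerivAt (fun y : ℝ => (x, y)) (0, 1) s :=
  (hasDerivAt_const s x).prodMk (hasDerivAt_id s)

lemma IsLaxFamily.hasDerivAt {F : SpectralFamily} (hF : IsLaxFamily D lam zeta q phi w F)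
    {x t : ℝ} (hx : (x, t) ∈ D) (k : Fin 2) :
    HasDerivAt (fun mu => F.fn mu x t k) (deriv (fun mu => F.fn mu x t) F.param k) F.param := by
  obtain ⟨O, hO, hm, -, h, -⟩ := hF
  exact hasDerivAt_pi.1 ((h x t hx).differentiableAt (hO.mem_nhds hm)).hasDerivAt k

/-- The `x`-equation differentiated in the spectral parameter; the inhomogeneous term is `(∂_λ U) f
= (-f⁽¹⁾, f⁽²⁾)`. -/
lemma IsLaxFamily.hasDerivAt_deriv_x (hD : IsOpen D) {F : SpectralFamily}
    (hF : IsLaxFamily D lam zeta q phi w F) {x t : ℝ} (hx : (x, t) ∈ D) :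
    HasDerivAt (fun y => deriv (fun mu => F.fn mu y t) F.param)
      (![-F.val x t 0, F.val x t 1] + laxU F.param (q x t) (conj (q x t)) *ᵥ
        deriv (fun mu => F.fn mu x t) F.param) x := by
  have hd := hF.hasDerivAt hx
  obtain ⟨O, hO, hm, hC, hh, hL⟩ := hF
  have hc : ∀ k, DifferentiableOn ℂ (fun mu => F.fn mu x t k) O := fun k =>
    differentiableOn_pi.1 (hh x t hx) k
  refine (hasDerivAt_deriv_of_contDiffOn hO hD (F := fun mu p => F.fn mu p.1 p.2) hC
    (fun p hp => hh p.1 p.2 hp) (hasDerivAt_prodMk_left t)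
    (fun mu hmu s hs => (hL mu hmu).psi_x s t hs) hm hx ?_).congr_deriv ?_
  · refine differentiableOn_pi.2 (Fin.forall_fin_two.2 ⟨?_, ?_⟩)
    · simp only [laxU_mulVec_zero]
      have := hc 0; have := hc 1
      fun_prop
    · simp only [laxU_mulVec_one]
      have := hc 0; have := hc 1
      fun_prop
  · refine HasDerivAt.deriv (hasDerivAt_pi.2 (Fin.forall_fin_two.2 ⟨?_, ?_⟩))
    · simp only [laxU_mulVec_zero]
      refine (((hasDerivAt_neg _).mul (hd 0)).add ((hd 1).const_mul _)).congr_deriv ?_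
      rw [Pi.add_apply, laxU_mulVec_zero]
      simp [SpectralFamily.val]
      ring
    · simp only [laxU_mulVec_one]
      refine (((hd 0).const_mul _).add ((hasDerivAt_id _).mul (hd 1))).congr_deriv ?_
      rw [Pi.add_apply, laxU_mulVec_one]
      simp [SpectralFamily.val]
      ring

lemma hasDerivAt_bracket {la mu : ℂ} (h : mu ≠ la) (p : Fin 2 → ℂ) {f : ℂ → Fin 2 → ℂ}
    {f' : Fin 2 → ℂ} (hf : ∀ k, HasDerivAt (fun nu => f nu k) (f' k) mu) :
    HasDerivAt (fun nu => bracket la p nu (f nu))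
      (bracket la p mu f' - bracket la p mu (f mu) / (mu - la)) mu := by
  have hne := sub_ne_zero.2 h
  simp only [bracket, wronskian]
  refine ((((hf 1).const_mul (p 0)).fun_sub ((hf 0).const_mul (p 1))).div
    (((hasDerivAt_id mu).sub_const la).const_mul 2)
    (mul_ne_zero two_ne_zero hne)).congr_deriv ?_
  simp only [id]
  field_simp

lemma IsLaxFamily.hasDerivAt_deriv_t (hD : IsOpen D) {F : SpectralFamily}
    (hF : IsLaxFamily D lam zeta q phi w F) (hp : F.param ∉ Set.range (poles lam zeta))
    {x t : ℝ} (hx : (x, t) ∈ D) :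
    HasDerivAt (fun s => deriv (fun mu => F.fn mu x s) F.param)
      (Complex.I • ![-4 * F.param * F.val x t 0 + 2 * q x t * F.val x t 1,
          2 * conj (q x t) * F.val x t 0 + 4 * F.param * F.val x t 1]
        - ∑ k, (bracket (poles lam zeta k) (sources phi w x t k) F.param (F.val x t)
            / (F.param - poles lam zeta k)) • sources phi w x t k
        + laxR lam zeta q phi w F.param x t *ᵥ deriv (fun mu => F.fn mu x t) F.param) t := by
  have hd := hF.hasDerivAt hx
  obtain ⟨O, hO, hm, hC, hh, hL⟩ := hF
  -- The matrix of the `t`-equation is holomorphic in the parameter only away from the poles, so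
  -- they are removed from the domain.
  let O' := O ∩ (Set.range (poles lam zeta))ᶜ
  have hO' : IsOpen O' := hO.inter (Set.finite_range _).isClosed.isOpen_compl
  have hsub : O' ⊆ O := Set.inter_subset_left
  have hpne : ∀ mu ∈ O', ∀ k, mu ≠ poles lam zeta k := fun mu hmu k e => hmu.2 ⟨k, e.symm⟩
  have hc : ∀ k, DifferentiableOn ℂ (fun mu => F.fn mu x t k) O' := fun k =>
    (differentiableOn_pi.1 (hh x t hx) k).mono hsub
  have hbr : ∀ k, DifferentiableOn ℂ (fun mu => bracket (poles lam zeta k) (sources phi w x t k) mu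
      (F.fn mu x t)) O' := fun k mu hmu =>
    ((hasDerivAt_bracket (hpne mu hmu k) (sources phi w x t k) (f := fun mu => F.fn mu x t)
      fun j => ((hc j).differentiableAt
        (hO'.mem_nhds hmu)).hasDerivAt).differentiableAt).differentiableWithinAt
  refine (hasDerivAt_deriv_of_contDiffOn hO' hD (F := fun mu p => F.fn mu p.1 p.2)
    (hC.mono (Set.prod_mono hsub subset_rfl))
    (fun p hp => (hh p.1 p.2 hp).mono hsub) (hasDerivAt_prodMk_right x)
    (fun mu hmu s hs => (hL mu (hsub hmu)).psi_t x s hs) ⟨hm, hp⟩ hx ?_).congr_deriv ?_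
  · refine differentiableOn_pi.2 (Fin.forall_fin_two.2 ⟨?_, ?_⟩)
    · simp only [laxR_mulVec_zero]
      have := hc 0; have := hc 1
      refine DifferentiableOn.add (by fun_prop) (DifferentiableOn.fun_sum fun k _ => ?_)
      exact (hbr k).mul_const _
    · simp only [laxR_mulVec_one]
      have := hc 0; have := hc 1
      refine DifferentiableOn.add (by fun_prop) (DifferentiableOn.fun_sum fun k _ => ?_)
      exact (hbr k).mul_const _
  · have hb := fun k => hasDerivAt_bracket (hpne F.param ⟨hm, hp⟩ k) (sources phi w x t k) hd
    have hid := hasDerivAt_id F.param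
    refine HasDerivAt.deriv (hasDerivAt_pi.2 (Fin.forall_fin_two.2 ⟨?_, ?_⟩))
    · simp only [laxR_mulVec_zero]
      refine ((((((((hid.pow 2).const_mul (-2)).add_const _).mul (hd 0)).add
        ((((hid.const_mul 2).mul_const _).sub_const _).mul (hd 1))).const_mul Complex.I).add
        (HasDerivAt.fun_sum fun k _ => (hb k).mul_const (sources phi w x t k 0)))).congr_deriv ?_
      simp only [sub_mul, Finset.sum_sub_distrib, Pi.add_apply, Pi.sub_apply, laxR_mulVec_zero,
        Pi.smul_apply, Finset.sum_apply, smul_eq_mul, SpectralFamily.val, id]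
      simp
      ring
    · simp only [laxR_mulVec_one]
      refine ((((((((hid.const_mul 2).mul_const _).add_const _).mul (hd 0)).add
        ((((hid.pow 2).const_mul 2).sub_const _).mul (hd 1))).const_mul Complex.I).add
        (HasDerivAt.fun_sum fun k _ => (hb k).mul_const (sources phi w x t k 1)))).congr_deriv ?_
      simp only [sub_mul, Finset.sum_sub_distrib, Pi.add_apply, Pi.sub_apply, laxR_mulVec_one,
        Pi.smul_apply, Finset.sum_apply, smul_eq_mul, SpectralFamily.val, id]
      simp
      ring

/-- The confluent case: diagonal entries obey the same formula as off-diagonal ones, so the whole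
matrix satisfies one rank-two law. -/
lemma IsLaxFamily.hasDerivAt_sigma_self_x (hD : IsOpen D) {F : SpectralFamily}
    (hF : IsLaxFamily D lam zeta q phi w F) {x t : ℝ} (hx : (x, t) ∈ D) :
    HasDerivAt (fun y => sigma F F y t)
      (1 / 2 * (F.val x t 0 * F.val x t 1 + F.val x t 1 * F.val x t 0)) x := by
  obtain ⟨f0, f1⟩ := hasDerivAt_fin_two.1 (hF.isLaxSolution.psi_x x t hx)
  obtain ⟨g0, g1⟩ := hasDerivAt_fin_two.1 (hF.hasDerivAt_deriv_x hD hx)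
  rw [laxU_mulVec_zero] at f0
  rw [laxU_mulVec_one] at f1
  rw [Pi.add_apply, laxU_mulVec_zero] at g0
  rw [Pi.add_apply, laxU_mulVec_one] at g1
  simp only [sigma, wronskian, if_true]
  refine (((f0.mul g1).sub (f1.mul g0)).const_mul _).congr_deriv ?_
  simp
  ring

lemma IsLaxFamily.hasDerivAt_sigma_self_t (hD : IsOpen D) {F : SpectralFamily}
    (hF : IsLaxFamily D lam zeta q phi w F) (hp : F.param ∉ Set.range (poles lam zeta))
    {x t : ℝ} (hx : (x, t) ∈ D) :
    HasDerivAt (fun s => sigma F F x s)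
      (Complex.I * ((F.param + F.param) * (F.val x t 0 * F.val x t 1 + F.val x t 1 * F.val x t 0)
        + conj (q x t) * (F.val x t 0 * F.val x t 0) - q x t * (F.val x t 1 * F.val x t 1))
      + ∑ k, bracket (poles lam zeta k) (sources phi w x t k) F.param (F.val x t)
        * bracket (poles lam zeta k) (sources phi w x t k) F.param (F.val x t)) t := by
  obtain ⟨f0, f1⟩ := hasDerivAt_fin_two.1 (hF.isLaxSolution.psi_t x t hx)
  obtain ⟨g0, g1⟩ := hasDerivAt_fin_two.1 (hF.hasDerivAt_deriv_t hD hp hx)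
  rw [laxR_mulVec_zero] at f0
  rw [laxR_mulVec_one] at f1
  rw [Pi.add_apply, laxR_mulVec_zero] at g0
  rw [Pi.add_apply, laxR_mulVec_one] at g1
  simp only [sigma, wronskian, if_true]
  refine (((f0.mul g1).sub (f1.mul g0)).const_mul _).congr_deriv ?_
  set d := deriv (fun mu => F.fn mu x t) F.param
  set p := sources phi w x t
  set l := poles lam zeta
  have e : ∀ k, bracket (l k) (p k) F.param (F.val x t) * bracket (l k) (p k) F.param (F.val x t)
      = 1 / 2 * (bracket (l k) (p k) F.param (F.val x t) * p k 0 * d 1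
        - bracket (l k) (p k) F.param (F.val x t) * p k 1 * d 0
        + bracket (l k) (p k) F.param d * p k 1 * F.val x t 0
        - bracket (l k) (p k) F.param d * p k 0 * F.val x t 1
        - bracket (l k) (p k) F.param (F.val x t) / (F.param - l k) * p k 1 * F.val x t 0
        + bracket (l k) (p k) F.param (F.val x t) / (F.param - l k) * p k 0 * F.val x t 1) := by
    intro k
    have hne : F.param ≠ l k := fun e => hp ⟨k, e.symm⟩
    have h0 := sub_ne_zero.2 hne
    have h1 := two_mul_bracket hne (p k) (F.val x t)
    have h2 := two_mul_bracket hne (p k) d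
    have h3 : bracket (l k) (p k) F.param (F.val x t) / (F.param - l k) * (F.param - l k)
      = bracket (l k) (p k) F.param (F.val x t) := div_mul_cancel₀ _ h0
    linear_combination (-1 / 2) * bracket (l k) (p k) F.param (F.val x t) * h2
      + (1 / 2) * bracket (l k) (p k) F.param d * h1
      - (1 / 2) * bracket (l k) (p k) F.param (F.val x t) / (F.param - l k) * h1
      - bracket (l k) (p k) F.param (F.val x t) * h3
  simp only [e, ← Finset.mul_sum, Finset.sum_sub_distrib, Finset.sum_add_distrib,
    ← Finset.sum_mul, Pi.sub_apply, Pi.smul_apply, Finset.sum_apply, smul_eq_mul]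
  simp
  ring

end SigmaDerivatives

/-! ## The symmetry `S₊` -/

section Symmetry

variable {m n : ℕ} {lam : Fin m → ℂ} {zeta : Fin n → ℂ}
    {q : ℝ → ℝ → ℂ} {phi : Fin m → ℝ → ℝ → Fin 2 → ℂ} {w : Fin n → ℝ → ℝ → ℂ}
    {D : Set (ℝ × ℝ)}

@[simp] lemma sPlus_zero (z : Fin 2 → ℂ) : sPlus z 0 = conj (z 1) := rfl

@[simp] lemma sPlus_one (z : Fin 2 → ℂ) : sPlus z 1 = conj (z 0) := rfl

@[simp] lemma realVec_zero (z : ℂ) : realVec z 0 = z := rfl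

@[simp] lemma realVec_one (z : ℂ) : realVec z 1 = conj z := rfl

lemma fin_two_ext {u v : Fin 2 → ℂ} (h0 : u 0 = v 0) (h1 : u 1 = v 1) : u = v :=
  funext (Fin.forall_fin_two.2 ⟨h0, h1⟩)

@[simp] lemma sPlus_sPlus (z : Fin 2 → ℂ) : sPlus (sPlus z) = z :=
  fin_two_ext (by simp) (by simp)

@[simp] lemma sPlus_realVec (z : ℂ) : sPlus (realVec z) = realVec z :=
  fin_two_ext (by simp) (by simp)

lemma conj_wronskian (u v : Fin 2 → ℂ) :
    conj (wronskian u v) = -wronskian (sPlus u) (sPlus v) := by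
  simp [wronskian]

lemma conj_bracket (la mu : ℂ) (p f : Fin 2 → ℂ) :
    conj (bracket la p mu f) = bracket (-conj la) (sPlus p) (-conj mu) (sPlus f) := by
  rw [bracket, map_div₀, conj_wronskian, bracket, ← neg_div_neg_eq]
  congr 1
  · ring
  · simp [map_ofNat]
    ring

/-- The permutation of the poles induced by `λ ↦ -λ*`. -/
def poleSwap (m n : ℕ) : Equiv.Perm ((Fin m ⊕ Fin m) ⊕ Fin n) :=
  Equiv.sumCongr (Equiv.sumComm _ _) (Equiv.refl _)

lemma neg_conj_of_re_eq_zero {z : ℂ} (h : z.re = 0) : -conj z = z := by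
  apply Complex.ext <;> simp [h]

lemma poles_poleSwap (hz : ∀ j, (zeta j).re = 0) (k : (Fin m ⊕ Fin m) ⊕ Fin n) :
    poles lam zeta (poleSwap m n k) = -conj (poles lam zeta k) := by
  rcases k with (k | k) | k
  · simp [poleSwap, poles]
  · simp [poleSwap, poles]
  · simp [poleSwap, poles, neg_conj_of_re_eq_zero (hz k)]

lemma sources_poleSwap (x t : ℝ) (k : (Fin m ⊕ Fin m) ⊕ Fin n) :
    sources phi w x t (poleSwap m n k) = sPlus (sources phi w x t k) := by
  rcases k with (k | k) | k <;> simp [poleSwap, sources]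

lemma deriv_conj (f : ℝ → ℂ) (x : ℝ) : deriv (fun y => conj (f y)) x = conj (deriv f x) :=
  deriv.star

lemma HasDerivAt.conj {f : ℝ → ℂ} {f' : ℂ} {x : ℝ} (h : HasDerivAt f f' x) :
    HasDerivAt (fun y => conj (f y)) (conj f') x :=
  h.star

lemma hasDerivAt_sPlus {f : ℝ → Fin 2 → ℂ} {f' : Fin 2 → ℂ} {s : ℝ} (h : HasDerivAt f f' s) :
    HasDerivAt (fun r => sPlus (f r)) (sPlus f') s := by
  obtain ⟨h0, h1⟩ := hasDerivAt_fin_two.1 h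
  exact hasDerivAt_fin_two.2 ⟨HasDerivAt.conj h1, HasDerivAt.conj h0⟩

lemma sPlus_laxU (mu q : ℂ) (f : Fin 2 → ℂ) :
    sPlus (laxU mu q (conj q) *ᵥ f) = laxU (-conj mu) q (conj q) *ᵥ sPlus f := by
  apply fin_two_ext
  · rw [sPlus_zero, laxU_mulVec_zero, laxU_mulVec_one]
    simp
    ring
  · rw [sPlus_one, laxU_mulVec_zero, laxU_mulVec_one]
    simp
    ring

/-- The map `λ ↦ -λ*` exchanges `λ_j` with `-λ_j*` and fixes the imaginary `ζ_j`, while `S₊`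
permutes the source vectors in the same way; reindexing the sum gives the claim. -/
lemma sPlus_laxR (hz : ∀ j, (zeta j).re = 0) (mu : ℂ) (x t : ℝ) (f : Fin 2 → ℂ) :
    sPlus (laxR lam zeta q phi w mu x t *ᵥ f)
      = laxR lam zeta q phi w (-conj mu) x t *ᵥ sPlus f := by
  have e : ∀ c, ∑ k, bracket (poles lam zeta k) (sources phi w x t k) (-conj mu) (sPlus f)
      * sources phi w x t k c = ∑ k, conj (bracket (poles lam zeta k) (sources phi w x t k) mu f)
        * sPlus (sources phi w x t k) c := by
    intro c
    rw [← Equiv.sum_comp (poleSwap m n)]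
    simp only [poles_poleSwap hz, sources_poleSwap, conj_bracket]
  apply fin_two_ext
  · rw [sPlus_zero, laxR_mulVec_zero, laxR_mulVec_one, e]
    simp [deriv_conj, map_ofNat]
    ring
  · rw [sPlus_one, laxR_mulVec_zero, laxR_mulVec_one, e]
    simp [deriv_conj, map_ofNat]
    ring

lemma IsLaxSolution.sPlus (hz : ∀ j, (zeta j).re = 0) {mu : ℂ} {psi : ℝ → ℝ → Fin 2 → ℂ}
    (h : IsLaxSolution D lam zeta q phi w mu psi) :
    IsLaxSolution D lam zeta q phi w (-conj mu) (fun x t => NLSESCS.sPlus (psi x t)) where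
  psi_x x t hx := by
    rw [← sPlus_laxU]
    exact hasDerivAt_sPlus (h.psi_x x t hx)
  psi_t x t hx := by
    rw [← sPlus_laxR hz]
    exact hasDerivAt_sPlus (h.psi_t x t hx)

/-- Conjugation inside and outside combine to a holomorphic function; the inner minus sign appears
in the derivative. -/
lemma hasDerivAt_sPlus_conj {f : ℂ → Fin 2 → ℂ} {f' : Fin 2 → ℂ} {mu : ℂ}
    (h : ∀ k, HasDerivAt (fun nu => f nu k) (f' k) mu) :
    HasDerivAt (fun nu => sPlus (f (-conj nu))) (-sPlus f') (-conj mu) := by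
  have key : ∀ k, HasDerivAt (fun nu => conj (f (-conj nu) k)) (-conj (f' k)) (-conj mu) := by
    intro k
    have h1 := (h k).conj_conj
    have h2 : HasDerivAt (fun nu : ℂ => -nu) (-1) (-conj mu) := hasDerivAt_neg _
    have h3 := HasDerivAt.comp (-conj mu) (h₂ := ⇑conj ∘ (fun nu => f nu k) ∘ ⇑conj)
      (h₂' := conj (f' k)) (by simpa using h1) h2
    simpa [Function.comp_def] using h3
  exact hasDerivAt_pi.2 (Fin.forall_fin_two.2 ⟨key 1, key 0⟩)

lemma contDiff_sPlus : ContDiff ℝ 1 sPlus := by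
  refine contDiff_pi.2 (Fin.forall_fin_two.2 ⟨?_, ?_⟩)
  · exact Complex.conjCLE.contDiff.comp (contDiff_apply ℝ ℂ (1 : Fin 2))
  · exact Complex.conjCLE.contDiff.comp (contDiff_apply ℝ ℂ (0 : Fin 2))

lemma IsLaxFamily.sPlus (hz : ∀ j, (zeta j).re = 0) {F : SpectralFamily}
    (hF : IsLaxFamily D lam zeta q phi w F) : IsLaxFamily D lam zeta q phi w F.sPlus := by
  obtain ⟨O, hO, hm, hC, hh, hL⟩ := hF
  have hcont : ContDiff ℝ 1 (fun nu : ℂ => -conj nu) := Complex.conjCLE.contDiff.neg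
  refine ⟨(fun nu => -conj nu) ⁻¹' O, hO.preimage hcont.continuous, ?_, ?_, ?_, ?_⟩
  · simpa [SpectralFamily.sPlus] using hm
  · refine contDiff_sPlus.comp_contDiffOn (hC.comp
      ((hcont.comp contDiff_fst).prodMk contDiff_snd).contDiffOn fun z hz => ⟨hz.1, hz.2⟩)
  · intro x t hx nu hnu
    have h1 := fun k => (differentiableAt_pi.1
      ((hh x t hx).differentiableAt (hO.mem_nhds hnu)) k).hasDerivAt
    have h2 := hasDerivAt_sPlus_conj h1
    simp only [map_neg, Complex.conj_conj, neg_neg] at h2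
    exact h2.differentiableAt.differentiableWithinAt
  · intro mu hmu
    have := (hL _ hmu).sPlus hz
    simpa [SpectralFamily.sPlus] using this

lemma neg_conj_inj {a b : ℂ} : -conj a = -conj b ↔ a = b := by
  rw [neg_inj, (starRingEnd ℂ).injective.eq_iff]

/-- `σ` of two conjugated families with different parameters. -/
lemma conj_sigma_of_ne {F G F' G' : SpectralFamily} (hFG : F.param ≠ G.param)
    (hF : F'.param = -conj F.param) (hG : G'.param = -conj G.param) {x t : ℝ}
    (hFv : F'.val x t = sPlus (F.val x t)) (hGv : G'.val x t = sPlus (G.val x t)) :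
    conj (sigma F G x t) = sigma F' G' x t := by
  rw [sigma, if_neg hFG, sigma, if_neg (by rwa [hF, hG, neg_conj_inj]), map_div₀, map_neg,
    conj_wronskian, hFv, hGv, hF, hG, ← neg_div_neg_eq]
  congr 1
  · ring
  · rw [map_mul, map_sub, map_ofNat]
    ring

lemma SpectralFamily.sPlus_val (F : SpectralFamily) (x t : ℝ) :
    F.sPlus.val x t = NLSESCS.sPlus (F.val x t) := by
  simp [SpectralFamily.val, SpectralFamily.sPlus]

/-- Two signs cancel: one from conjugating a Wronskian, one from differentiating `λ ↦ -λ*`. -/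
lemma IsLaxFamily.conj_sigma_self {F : SpectralFamily} (hF : IsLaxFamily D lam zeta q phi w F)
    {x t : ℝ} (hx : (x, t) ∈ D) : conj (sigma F F x t) = sigma F.sPlus F.sPlus x t := by
  have h := (hasDerivAt_sPlus_conj (hF.hasDerivAt hx)).deriv
  have h' : deriv (fun mu => F.sPlus.fn mu x t) F.sPlus.param
      = -NLSESCS.sPlus (deriv (fun mu => F.fn mu x t) F.param) := h
  rw [sigma, sigma, if_pos rfl, if_pos rfl, h', map_mul, conj_wronskian, F.sPlus_val]
  simp [wronskian, map_ofNat]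
  ring

lemma IsSelfConjugate.val {F : SpectralFamily} (h : IsSelfConjugate D F) (hre : F.param.re = 0)
    {x t : ℝ} (hx : (x, t) ∈ D) : NLSESCS.sPlus (F.val x t) = F.val x t := by
  have h0 : F.val x t 0 = conj (F.val x t 1) := h.self_of_nhds hre x t hx
  exact fin_two_ext (by simp [h0]) (by simp [h0])

lemma IsSelfConjugate.conj_sigma_self {F : SpectralFamily} (h : IsSelfConjugate D F)
    (hF : IsLaxFamily D lam zeta q phi w F) (hre : F.param.re = 0)
    {x t : ℝ} (hx : (x, t) ∈ D) : conj (sigma F F x t) = sigma F F x t := by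
  have hv0 : F.val x t 0 = conj (F.val x t 1) := h.self_of_nhds hre x t hx
  set d := deriv (fun mu => F.fn mu x t) F.param with hd
  -- Self-conjugacy is known only on the imaginary axis, so it is differentiated in that direction;
  -- the factor `I` produces the sign in `d 0 = -conj (d 1)`.
  have hl : HasDerivAt (fun s : ℝ => F.param + (s : ℂ) * Complex.I) (1 * Complex.I) 0 :=
    ((hasDerivAt_id (0 : ℝ)).ofReal_comp.mul_const Complex.I).const_add _
  have hk : ∀ k, HasDerivAt (fun s : ℝ => F.fn (F.param + (s : ℂ) * Complex.I) x t k)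
      (d k * Complex.I) 0 := by
    intro k
    have := HasDerivAt.scomp (0 : ℝ) (h := fun s : ℝ => F.param + (s : ℂ) * Complex.I)
      (g₁ := fun mu => F.fn mu x t k) (by simpa using hF.hasDerivAt hx k) hl
    simpa [Function.comp_def, mul_comm] using this
  have he : ∀ᶠ s : ℝ in 𝓝 0, F.fn (F.param + (s : ℂ) * Complex.I) x t 0
      = conj (F.fn (F.param + (s : ℂ) * Complex.I) x t 1) := by
    have hc : Filter.Tendsto (fun s : ℝ => F.param + (s : ℂ) * Complex.I) (𝓝 0) (𝓝 F.param) := by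
      simpa using hl.continuousAt.tendsto
    filter_upwards [hc.eventually h] with s hs
    exact hs (by simp [hre]) x t hx
  have h1 := ((HasDerivAt.conj (hk 1)).congr_of_eventuallyEq he).unique (hk 0)
  have h2 : d 0 = -conj (d 1) := by
    have : conj (d 1) * -Complex.I = d 0 * Complex.I := by simpa using h1
    linear_combination Complex.I * this + (d 0 + conj (d 1)) * Complex.I_sq
  rw [sigma, if_pos rfl, ← hd, wronskian, hv0, h2]
  simp [map_ofNat]
  ring

end Symmetry

/-! ### Matrices whose conjugate is a simultaneous permutation of rows and columns -/

section BilinearSymmetry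

variable {ι : Type} [Fintype ι] [DecidableEq ι] {A : Matrix ι ι ℂ} {τ : Equiv.Perm ι}

lemma conj_det_of_perm (hA : ∀ i j, conj (A i j) = A (τ i) (τ j)) : conj A.det = A.det := by
  rw [RingHom.map_det, ← det_submatrix_equiv_self τ A]
  congr 1
  ext i j
  exact hA i j

lemma conj_bil (hdet : A.det ≠ 0) (hA : ∀ i j, conj (A i j) = A (τ i) (τ j))
    {y z y' z' : ι → ℂ} (hy : ∀ i, conj (y i) = y' (τ i)) (hz : ∀ i, conj (z i) = z' (τ i)) :
    conj (bil A y z) = bil A y' z' := by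
  set u := A⁻¹ *ᵥ z with hu
  have h1 : A *ᵥ u = z := by rw [hu, mulVec_mulVec, mul_nonsing_inv _ hdet.isUnit, one_mulVec]
  -- Conjugating and permuting the solution of `A u = z` solves the system with right side `z'`, so
  -- the inverse itself need not be conjugated.
  have h2 : A *ᵥ (fun i => conj (u (τ.symm i))) = z' := by
    ext i
    have := congrArg conj (congrFun h1 (τ.symm i))
    rw [hz, Equiv.apply_symm_apply] at this
    rw [← this, mulVec, dotProduct, mulVec, dotProduct, map_sum, ← Equiv.sum_comp τ]
    exact Finset.sum_congr rfl fun j _ => by simp [hA]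
  rw [bil, bil, ← hu, ← h2, mulVec_mulVec, nonsing_inv_mul _ hdet.isUnit, one_mulVec,
    dotProduct, dotProduct, map_sum, ← Equiv.sum_comp τ (fun j => y' j * _)]
  exact Finset.sum_congr rfl fun j _ => by simp [hy]

end BilinearSymmetry

/-! ## The data of the transformation -/

section Indices

variable {m n M N : ℕ}

/-- The indices of the poles of the original Lax pair among those of the transformed one. -/
def oldPole (M N : ℕ) : (Fin m ⊕ Fin m) ⊕ Fin n → (Fin (m + M) ⊕ Fin (m + M)) ⊕ Fin (n + N) :=
  Sum.map (Sum.map (Fin.castAdd M) (Fin.castAdd M)) (Fin.castAdd N)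

/-- The indices of the poles created by the transformation. -/
def newPole (m n : ℕ) :
    Fin N ⊕ (Fin M ⊕ Fin M) → (Fin (m + M) ⊕ Fin (m + M)) ⊕ Fin (n + N) :=
  Sum.elim (fun j => .inr (Fin.natAdd n j))
    (Sum.elim (fun j => .inl (.inl (Fin.natAdd m j))) (fun j => .inl (.inr (Fin.natAdd m j))))

lemma newPole_injective : Function.Injective (newPole (M := M) (N := N) m n) := by
  rintro (i | i | i) (j | j | j) h <;> simp [newPole] at h ⊢ <;> exact h

lemma oldPole_ne_newPole (k : (Fin m ⊕ Fin m) ⊕ Fin n) (i : Fin N ⊕ (Fin M ⊕ Fin M)) :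
    oldPole M N k ≠ newPole m n i := by
  rcases k with (k | k) | k <;> rcases i with i | i | i <;> simp [oldPole, newPole, Fin.ext_iff] <;>
    omega

lemma sum_poles {E : Type*} [AddCommMonoid E]
    (f : (Fin (m + M) ⊕ Fin (m + M)) ⊕ Fin (n + N) → E) :
    ∑ k, f k = ∑ k, f (oldPole M N k) + ∑ i, f (newPole m n i) := by
  simp only [Fintype.sum_sum_type, Fin.sum_univ_add, oldPole, newPole, Sum.map_inl, Sum.map_inr,
    Sum.elim_inl, Sum.elim_inr]
  abel

lemma poles_oldPole (lam : Fin m → ℂ) (zeta : Fin n → ℂ) (lam' : Fin M → ℂ) (zeta' : Fin N → ℂ)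
    (k : (Fin m ⊕ Fin m) ⊕ Fin n) :
    poles (Fin.append lam lam') (Fin.append zeta zeta') (oldPole M N k) = poles lam zeta k := by
  rcases k with (k | k) | k <;> simp [poles, oldPole]

variable (T : DarbouxData M N)

namespace DarbouxData

/-- The spectral parameters of the families. -/
def params (i : Fin N ⊕ (Fin M ⊕ Fin M)) : ℂ := (T.families i).param

/-- The `k`-th components of the families. -/
def comps (k : Fin 2) (x t : ℝ) (i : Fin N ⊕ (Fin M ⊕ Fin M)) : ℂ := (T.families i).val x t k

/-- The matrix of which `Δ` is the determinant. -/
def mat (x t : ℝ) : Matrix (Fin N ⊕ (Fin M ⊕ Fin M)) (Fin N ⊕ (Fin M ⊕ Fin M)) ℂ :=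
  gram T.scalars T.families x t

/-- Square roots of the derivatives of the scalars. -/
def roots (t : ℝ) : Fin N ⊕ (Fin M ⊕ Fin M) → ℂ :=
  Sum.elim (fun j => (Real.sqrt (deriv (T.c j) t) : ℂ))
    (Sum.elim (fun j => Complex.sqrt (deriv (T.d j) t))
      (fun j => conj (Complex.sqrt (deriv (T.d j) t))))

/-- The dressing of a vector `p` whose brackets with the families are `v`. -/
def dress (p : Fin 2 → ℂ) (v : Fin N ⊕ (Fin M ⊕ Fin M) → ℂ) (x t : ℝ) : Fin 2 → ℂ :=
  fun k => p k - bil (T.mat x t) (T.comps k x t) v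

/-- The brackets of the families with a vector `p` at the parameter `mu`. -/
def brackets (mu : ℂ) (p : Fin 2 → ℂ) (x t : ℝ) (i : Fin N ⊕ (Fin M ⊕ Fin M)) : ℂ :=
  bracket mu p (T.params i) ((T.families i).val x t)

/-- The permutation of the families induced by `S₊`. -/
def swap (M N : ℕ) : Equiv.Perm (Fin N ⊕ (Fin M ⊕ Fin M)) :=
  Equiv.sumCongr (Equiv.refl _) (Equiv.sumComm _ _)

lemma mat_apply_ne {i j : Fin N ⊕ (Fin M ⊕ Fin M)} (h : i ≠ j) (x t : ℝ) :
    T.mat x t i j = sigma (T.families i) (T.families j) x t := by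
  simp [DarbouxData.mat, gram, h]

end DarbouxData

lemma poles_newPole (lam : Fin m → ℂ) (zeta : Fin n → ℂ) (i : Fin N ⊕ (Fin M ⊕ Fin M)) :
    poles (Fin.append lam T.lam) (Fin.append zeta T.zeta) (newPole m n i) = T.params i := by
  rcases i with i | i | i <;> simp [poles, newPole, DarbouxData.params, DarbouxData.families,
    DarbouxData.fFam, DarbouxData.gFam, SpectralFamily.sPlus]

lemma sigma_single {F : SpectralFamily} {mu : ℂ} (h : F.param ≠ mu) (psi : ℝ → ℝ → Fin 2 → ℂ)
    (x t : ℝ) :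
    sigma F (SpectralFamily.single mu psi) x t = bracket mu (psi x t) F.param (F.val x t) := by
  have h' : F.param ≠ (SpectralFamily.single mu psi).param := h
  rw [sigma, if_neg h', bracket]
  simp only [wronskian, SpectralFamily.single, SpectralFamily.val]
  congr 1
  ring

end Indices

/-- The hypotheses of the Darboux transformation. -/
structure IsDarbouxSetup {m n M N : ℕ} (Ω : Set (ℝ × ℝ)) (lam : Fin m → ℂ) (zeta : Fin n → ℂ)
    (q : ℝ → ℝ → ℂ) (phi : Fin m → ℝ → ℝ → Fin 2 → ℂ) (w : Fin n → ℝ → ℝ → ℂ)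
    (T : DarbouxData M N) : Prop where
  isOpen : IsOpen Ω
  sol : IsSolution Ω lam zeta q phi w
  spec : AdmissibleSpectrum (Fin.append lam T.lam) (Fin.append zeta T.zeta)
  f_lax : ∀ j, IsLaxFamily Ω lam zeta q phi w (T.fFam j)
  f_conj : ∀ j, IsSelfConjugate Ω (T.fFam j)
  c_diff : ∀ j, ∀ x t, (x, t) ∈ Ω → DifferentiableAt ℝ (T.c j) t ∧ 0 ≤ deriv (T.c j) t
  g_lax : ∀ j, IsLaxFamily Ω lam zeta q phi w (T.gFam j)
  d_diff : ∀ j, ∀ x t, (x, t) ∈ Ω → DifferentiableAt ℝ (T.d j) t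

/-! ### Evolution and symmetry of the matrix of the transformation -/

namespace IsDarbouxSetup

variable {m n M N : ℕ} {Ω : Set (ℝ × ℝ)} {lam : Fin m → ℂ} {zeta : Fin n → ℂ}
    {q : ℝ → ℝ → ℂ} {phi : Fin m → ℝ → ℝ → Fin 2 → ℂ} {w : Fin n → ℝ → ℝ → ℂ}
    {T : DarbouxData M N} (S : IsDarbouxSetup Ω lam zeta q phi w T) {x t : ℝ}
include S

lemma params_injective : Function.Injective T.params := by
  intro i j h
  rw [← poles_newPole T lam zeta, ← poles_newPole T lam zeta] at h
  exact newPole_injective (S.spec.distinct h)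

lemma poles_ne_params (k : (Fin m ⊕ Fin m) ⊕ Fin n) (i) : poles lam zeta k ≠ T.params i := by
  rw [← poles_newPole T lam zeta, ← poles_oldPole lam zeta T.lam T.zeta k]
  exact fun h => oldPole_ne_newPole k i (S.spec.distinct h)

lemma params_notMem (i) : T.params i ∉ Set.range (poles lam zeta) := by
  rintro ⟨k, hk⟩
  exact S.poles_ne_params k i hk

lemma families_lax (i) : IsLaxFamily Ω lam zeta q phi w (T.families i) := by
  rcases i with i | i | i
  · exact S.f_lax i
  · exact S.g_lax i
  · exact (S.g_lax i).sPlus S.sol.spectrum.zeta_re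

lemma zeta_re (j : Fin N) : (T.fFam j).param.re = 0 := by
  simpa [DarbouxData.fFam] using S.spec.zeta_re (Fin.natAdd n j)

lemma isCauchyLike (hΔ : T.Delta x t ≠ 0) :
    IsCauchyLike (T.mat x t) T.params (T.comps 0 x t) (T.comps 1 x t) where
  det_ne := hΔ
  symm := by
    ext i j
    rw [transpose_apply]
    by_cases h : i = j
    · rw [h]
    · rw [T.mat_apply_ne h, T.mat_apply_ne (Ne.symm h),
        sigma_symm _ _ fun e => absurd (S.params_injective e) (Ne.symm h)]
  comm i j := by
    by_cases h : i = j
    · rw [h]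
      ring
    · rw [T.mat_apply_ne h]
      exact sigma_comm_relation _ _ (fun e => h (S.params_injective e)) x t

lemma hasDerivAt_mat_x (hx : (x, t) ∈ Ω) (i j) : HasDerivAt (fun y => T.mat y t i j)
    ((1 / 2) * (T.comps 0 x t i * T.comps 1 x t j + T.comps 1 x t i * T.comps 0 x t j)) x := by
  refine HasDerivAt.const_add _ ?_
  by_cases h : i = j
  · rw [← h]
    exact (S.families_lax i).hasDerivAt_sigma_self_x S.isOpen hx
  · exact hasDerivAt_sigma_x (fun e => h (S.params_injective e))
      ((S.families_lax i).isLaxSolution.psi_x x t hx)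
      ((S.families_lax j).isLaxSolution.psi_x x t hx)

lemma isXFlow (hx : (x, t) ∈ Ω) (hΔ : T.Delta x t ≠ 0) :
    IsXFlow (fun y => T.mat y t) T.params (fun y => T.comps 0 y t) (fun y => T.comps 1 y t)
      (q x t) (conj (q x t)) x where
  cauchy := S.isCauchyLike hΔ
  gram' := S.hasDerivAt_mat_x hx
  a1' := hasDerivAt_pi.2 fun i => by
    refine (hasDerivAt_pi.1 ((S.families_lax i).isLaxSolution.psi_x x t hx) 0).congr_deriv ?_
    rw [laxU_mulVec_zero]
    simp [DarbouxData.comps, DarbouxData.params]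
  a2' := hasDerivAt_pi.2 fun i => by
    refine (hasDerivAt_pi.1 ((S.families_lax i).isLaxSolution.psi_x x t hx) 1).congr_deriv ?_
    rw [laxU_mulVec_one]
    simp [DarbouxData.comps, DarbouxData.params]

/-- For the real scalars, the sign condition on the derivative is what makes the square of
`Real.sqrt` return it; the complex square root needs no condition. -/
lemma hasDerivAt_scalars (hx : (x, t) ∈ Ω) (i) :
    HasDerivAt (T.scalars i) (T.roots t i ^ 2) t := by
  have hsq : ∀ z : ℂ, Complex.sqrt z ^ 2 = z := fun z => by
    simp [Complex.sqrt]
  rcases i with i | i | i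
  · obtain ⟨h1, h2⟩ := S.c_diff i x t hx
    refine h1.hasDerivAt.ofReal_comp.congr_deriv ?_
    rw [DarbouxData.roots, Sum.elim_inl, ← Complex.ofReal_pow, Real.sq_sqrt h2]
  · refine (S.d_diff i x t hx).hasDerivAt.congr_deriv ?_
    simp [DarbouxData.roots, hsq]
  · refine (HasDerivAt.conj (S.d_diff i x t hx).hasDerivAt).congr_deriv ?_
    simp [DarbouxData.roots, ← map_pow, hsq]

/-- The sources of the flow are the old ones together with fictitious zero vectors at the new
parameters, with brackets `roots i • e_i`. The latter contribute to the matrix exactly the diagonal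
of derivatives of the scalars and nothing to the equations of the families. -/
lemma isTFlow (hx : (x, t) ∈ Ω) (hΔ : T.Delta x t ≠ 0) :
    IsTFlow (fun s => T.mat x s) T.params (fun s => T.comps 0 x s) (fun s => T.comps 1 x s)
      (q x t) (conj (q x t)) (deriv (fun y => q y t) x) (deriv (fun y => conj (q y t)) x)
      (Sum.elim (poles lam zeta) T.params)
      (Sum.elim (fun k => sources phi w x t k 0) 0) (Sum.elim (fun k => sources phi w x t k 1) 0)
      (Sum.elim (fun k => T.brackets (poles lam zeta k) (sources phi w x t k) x t)
        (fun i => T.roots t i • Pi.single i 1)) t where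
  cauchy := S.isCauchyLike hΔ
  gram' i j := by
    have h1 : HasDerivAt (fun s => if i = j then T.scalars i s else 0)
        (∑ k, (T.roots t k • (Pi.single k 1 : _ → ℂ)) i
          * (T.roots t k • (Pi.single k 1 : _ → ℂ)) j) t := by
      by_cases h : i = j
      · subst h
        simp only [if_true]
        refine (S.hasDerivAt_scalars hx i).congr_deriv ?_
        simp [Pi.single_apply, pow_two]
      · simp only [h, if_false]
        refine (hasDerivAt_const t (0 : ℂ)).congr_deriv ?_
        refine (Finset.sum_eq_zero fun k _ => ?_).symm
        by_cases hk : i = k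
        · have : j ≠ k := fun e => h (hk.trans e.symm)
          simp [Pi.single_apply, this]
        · simp [Pi.single_apply, hk]
    have h2 : HasDerivAt (fun s => sigma (T.families i) (T.families j) x s)
        (Complex.I * ((T.params i + T.params j)
            * (T.comps 0 x t i * T.comps 1 x t j + T.comps 1 x t i * T.comps 0 x t j)
          + conj (q x t) * (T.comps 0 x t i * T.comps 0 x t j)
          - q x t * (T.comps 1 x t i * T.comps 1 x t j))
        + ∑ k, T.brackets (poles lam zeta k) (sources phi w x t k) x t i
          * T.brackets (poles lam zeta k) (sources phi w x t k) x t j) t := by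
      by_cases h : i = j
      · subst h
        exact (S.families_lax i).hasDerivAt_sigma_self_t S.isOpen (S.params_notMem i) hx
      · exact hasDerivAt_sigma_t (fun e => h (S.params_injective e))
          (S.families_lax i).isLaxSolution (S.families_lax j).isLaxSolution
          (S.params_notMem i) (S.params_notMem j) hx
    refine (h1.add h2).congr_deriv ?_
    rw [Fintype.sum_sum_type (α₁ := (Fin m ⊕ Fin m) ⊕ Fin n)]
    simp only [Sum.elim_inl, Sum.elim_inr]
    ring
  a1' := hasDerivAt_pi.2 fun i => by
    refine (hasDerivAt_pi.1 ((S.families_lax i).isLaxSolution.psi_t x t hx) 0).congr_deriv ?_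
    rw [laxR_mulVec_zero]
    simp [DarbouxData.comps, DarbouxData.params, DarbouxData.brackets, Fintype.sum_sum_type,
      mul_comm (sources _ _ _ _ _ _)]
    ring
  a2' := hasDerivAt_pi.2 fun i => by
    refine (hasDerivAt_pi.1 ((S.families_lax i).isLaxSolution.psi_t x t hx) 1).congr_deriv ?_
    rw [laxR_mulVec_one]
    simp [DarbouxData.comps, DarbouxData.params, DarbouxData.brackets, Fintype.sum_sum_type,
      mul_comm (sources _ _ _ _ _ _)]
    ring
  source k := by
    rcases k with k | k
    · ext i
      have := two_mul_bracket (S.poles_ne_params k i).symm (sources phi w x t k)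
        ((T.families i).val x t)
      simp [DarbouxData.brackets, DarbouxData.comps]
      linear_combination (-1 / 2) * this
    · ext i
      by_cases h : i = k
      · simp [h]
      · simp [h]

lemma eventually_x (hx : (x, t) ∈ Ω) (hΔ : T.Delta x t ≠ 0) :
    ∀ᶠ y in 𝓝 x, (y, t) ∈ Ω ∧ T.Delta y t ≠ 0 := by
  have h1 : ContinuousAt (fun y => T.Delta y t) x :=
    (S.isXFlow hx hΔ).hasDerivAt_det.continuousAt
  have h2 : ContinuousAt (fun y : ℝ => (y, t)) x := by fun_prop
  exact (h2.eventually (S.isOpen.mem_nhds hx)).and (h1.eventually_ne hΔ)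

lemma eventually_t (hx : (x, t) ∈ Ω) (hΔ : T.Delta x t ≠ 0) :
    ∀ᶠ s in 𝓝 t, (x, s) ∈ Ω ∧ T.Delta x s ≠ 0 := by
  have h1 : ContinuousAt (fun s => T.Delta x s) t :=
    (hasDerivAt_det (S.isTFlow hx hΔ).gram_eq hΔ).continuousAt
  have h2 : ContinuousAt (fun s : ℝ => (x, s)) t := by fun_prop
  exact (h2.eventually (S.isOpen.mem_nhds hx)).and (h1.eventually_ne hΔ)

/-! ### Symmetry -/

lemma params_swap (i) : T.params (DarbouxData.swap M N i) = -conj (T.params i) := by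
  rcases i with i | i | i
  · exact (neg_conj_of_re_eq_zero (S.zeta_re i)).symm
  · rfl
  · simp [DarbouxData.params, DarbouxData.swap, DarbouxData.families, SpectralFamily.sPlus]

lemma val_swap (hx : (x, t) ∈ Ω) (i) :
    (T.families (DarbouxData.swap M N i)).val x t = sPlus ((T.families i).val x t) := by
  rcases i with i | i | i
  · exact ((S.f_conj i).val (S.zeta_re i) hx).symm
  · exact (T.gFam i).sPlus_val x t
  · change (T.gFam i).val x t = sPlus ((T.gFam i).sPlus.val x t)
    rw [SpectralFamily.sPlus_val, sPlus_sPlus]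

lemma conj_mat (hx : (x, t) ∈ Ω) (i j) :
    conj (T.mat x t i j) = T.mat x t (DarbouxData.swap M N i) (DarbouxData.swap M N j) := by
  by_cases h : i = j
  · subst h
    simp only [DarbouxData.mat, gram, of_apply, if_true, map_add]
    congr 1
    · rcases i with i | i | i <;> simp [DarbouxData.scalars, DarbouxData.swap]
    · rcases i with i | i | i
      · exact (S.f_conj i).conj_sigma_self (S.f_lax i) (S.zeta_re i) hx
      · exact (S.g_lax i).conj_sigma_self hx
      · change conj (sigma (T.gFam i).sPlus (T.gFam i).sPlus x t) = sigma (T.gFam i) (T.gFam i) x t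
        rw [← (S.g_lax i).conj_sigma_self hx, Complex.conj_conj]
  · rw [T.mat_apply_ne h, T.mat_apply_ne fun e => h ((DarbouxData.swap M N).injective e)]
    exact conj_sigma_of_ne (fun e => h (S.params_injective e)) (S.params_swap i) (S.params_swap j)
      (S.val_swap hx i) (S.val_swap hx j)

lemma conj_comps_zero (hx : (x, t) ∈ Ω) (i) :
    conj (T.comps 0 x t i) = T.comps 1 x t (DarbouxData.swap M N i) := by
  simp [DarbouxData.comps, S.val_swap hx i]

lemma conj_comps_one (hx : (x, t) ∈ Ω) (i) :
    conj (T.comps 1 x t i) = T.comps 0 x t (DarbouxData.swap M N i) := by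
  simp [DarbouxData.comps, S.val_swap hx i]

lemma conj_Delta (hx : (x, t) ∈ Ω) : conj (T.Delta x t) = T.Delta x t :=
  conj_det_of_perm (S.conj_mat hx)

lemma sPlus_dress (hx : (x, t) ∈ Ω) (hΔ : T.Delta x t ≠ 0) (p : Fin 2 → ℂ) {v v' : _ → ℂ}
    (hv : ∀ i, conj (v i) = v' (DarbouxData.swap M N i)) :
    sPlus (T.dress p v x t) = T.dress (sPlus p) v' x t := by
  apply fin_two_ext
  · simp only [DarbouxData.dress, sPlus_zero, map_sub]
    rw [conj_bil (A := T.mat x t) hΔ (S.conj_mat hx) (S.conj_comps_one hx) hv]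
  · simp only [DarbouxData.dress, sPlus_one, map_sub]
    rw [conj_bil (A := T.mat x t) hΔ (S.conj_mat hx) (S.conj_comps_zero hx) hv]

lemma conj_brackets (hx : (x, t) ∈ Ω) (mu : ℂ) (p : Fin 2 → ℂ) (i) :
    conj (T.brackets mu p x t i)
      = T.brackets (-conj mu) (sPlus p) x t (DarbouxData.swap M N i) := by
  rw [DarbouxData.brackets, conj_bracket, DarbouxData.brackets, S.val_swap hx, S.params_swap]

end IsDarbouxSetup

/-! ### Bordered determinants as dressed vectors -/

namespace DarbouxData

variable {m n M N : ℕ} (T : DarbouxData M N) {x t : ℝ}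

lemma transform_eq_dress (hΔ : T.Delta x t ≠ 0) {mu : ℂ} (hmu : ∀ i, mu ≠ T.params i)
    (psi : ℝ → ℝ → Fin 2 → ℂ) :
    T.transform mu psi x t = T.dress (psi x t) (T.brackets mu (psi x t) x t) x t := by
  ext k
  have h := det_bordered (A := T.mat x t) hΔ
    (fun i => sigma (T.families i) (SpectralFamily.single mu psi) x t) (T.comps k x t) (psi x t k)
  rw [transform, Pi.smul_apply, smul_eq_mul]
  refine (congrArg ((T.Delta x t)⁻¹ * ·) h).trans ?_
  change (T.Delta x t)⁻¹ * (T.Delta x t * _) = _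
  rw [inv_mul_cancel_left₀ hΔ, dress]
  congr 2
  ext i
  exact sigma_single (hmu i).symm psi x t

lemma qBar_eq (hΔ : T.Delta x t ≠ 0) (q : ℝ → ℝ → ℂ) :
    T.qBar q x t = q x t - bil (T.mat x t) (T.comps 0 x t) (T.comps 0 x t) := by
  have h := det_bordered (A := T.mat x t) hΔ (T.comps 0 x t) (T.comps 0 x t) 0
  rw [qBar]
  refine (congrArg (fun z => q x t + (T.Delta x t)⁻¹ * z) h).trans ?_
  change q x t + (T.Delta x t)⁻¹ * (T.Delta x t * _) = _
  rw [inv_mul_cancel_left₀ hΔ]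
  ring

/-- Both readings of the quotient give one expression. For a nonzero scalar, the border is column
`i` of the matrix minus the scalar times `e_i`, and the column part cancels the corner; for a zero
scalar, the smaller determinant is evaluated by Cramer's rule. -/
lemma W1Div_eq (hΔ : T.Delta x t ≠ 0) (i : Fin N ⊕ (Fin M ⊕ Fin M)) (k : Fin 2) :
    W1Div T.scalars T.families i x t k
      = T.Delta x t * bil (T.mat x t) (T.comps k x t) (Pi.single i 1) := by
  by_cases hC : T.scalars i t = 0
  · rw [W1Div, if_pos hC]
    refine Eq.trans ?_ (det_bordered_ne (A := T.mat x t) hΔ i (T.comps k x t))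
    rw [W1]
    congr 2
    · ext a b
      simp [mat, gram, Subtype.ext_iff]
    · ext a b
      exact (T.mat_apply_ne a.2 x t).symm
  · rw [W1Div, if_neg hC, Pi.smul_apply, smul_eq_mul]
    have h := det_bordered (A := T.mat x t) hΔ
      (fun j => sigma (T.families j) (T.families i) x t) (T.comps k x t) (T.comps k x t i)
    refine (congrArg ((T.scalars i t)⁻¹ * ·) h).trans ?_
    have e : (fun j => sigma (T.families j) (T.families i) x t)
        = (fun j => T.mat x t j i) - T.scalars i t • Pi.single i 1 := by
      ext j
      by_cases hj : j = i
      · subst hj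
        simp [mat, gram]
      · simp [T.mat_apply_ne hj, hj]
    rw [e, bil_sub_right, bil_smul_right, bil_self_col (A := T.mat x t) hΔ, sub_sub_cancel]
    change _ * (T.Delta x t * _) = _
    field_simp

lemma conj_single (c : ℂ) (i j : Fin N ⊕ (Fin M ⊕ Fin M)) :
    conj ((c • (Pi.single i 1 : _ → ℂ)) j)
      = (conj c • (Pi.single (swap M N i) 1 : _ → ℂ)) (swap M N j) := by
  simp only [Pi.smul_apply, Pi.single_apply, (swap M N).injective.eq_iff]
  split_ifs <;> simp

/-- The normalised determinant is the negative of the dressing of a zero source. -/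
lemma phiBar_natAdd (lam : Fin m → ℂ) (phi : Fin m → ℝ → ℝ → Fin 2 → ℂ)
    (hΔ : T.Delta x t ≠ 0) (j : Fin M) :
    T.phiBar lam phi (Fin.natAdd m j) x t
      = -T.dress 0 (T.roots t (.inr (.inl j)) • Pi.single (.inr (.inl j)) 1) x t := by
  ext k
  simp only [phiBar, Fin.append_right, Pi.smul_apply, smul_eq_mul, T.W1Div_eq hΔ,
    dress, Pi.neg_apply, bil_smul_right, Pi.zero_apply, roots,
    Sum.elim_inl, Sum.elim_inr]
  field_simp
  ring

lemma mul_brackets {mu : ℂ} (hmu : ∀ i, mu ≠ T.params i) (p : Fin 2 → ℂ) (x t : ℝ) :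
    T.params * T.brackets mu p x t = mu • T.brackets mu p x t
      - (1 / 2 : ℂ) • (p 1 • T.comps 0 x t - p 0 • T.comps 1 x t) := by
  ext i
  have := two_mul_bracket (hmu i).symm p ((T.families i).val x t)
  simp only [brackets, comps, Pi.mul_apply, Pi.sub_apply, Pi.smul_apply,
    smul_eq_mul]
  linear_combination (-1 / 2) * this

end DarbouxData

lemma sum_sq_sources {m n : ℕ} (phi : Fin m → ℝ → ℝ → Fin 2 → ℂ) (w : Fin n → ℝ → ℝ → ℂ)
    (x t : ℝ) :
    ∑ j, (phi j x t 0 ^ 2 + conj (phi j x t 1) ^ 2) + ∑ j, w j x t ^ 2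
      = ∑ k, sources phi w x t k 0 ^ 2 := by
  simp [sources, Fintype.sum_sum_type, Finset.sum_add_distrib]

lemma bracket_neg (la mu : ℂ) (p f : Fin 2 → ℂ) : bracket la (-p) mu f = -bracket la p mu f := by
  simp [bracket, wronskian]
  ring

namespace IsDarbouxSetup

variable {m n M N : ℕ} {Ω : Set (ℝ × ℝ)} {lam : Fin m → ℂ} {zeta : Fin n → ℂ}
    {q : ℝ → ℝ → ℂ} {phi : Fin m → ℝ → ℝ → Fin 2 → ℂ} {w : Fin n → ℝ → ℝ → ℂ}
    {T : DarbouxData M N} (S : IsDarbouxSetup Ω lam zeta q phi w T) {x t : ℝ}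
include S

lemma conj_qBar (hx : (x, t) ∈ Ω) (hΔ : T.Delta x t ≠ 0) :
    conj (T.qBar q x t)
      = conj (q x t) - bil (T.mat x t) (T.comps 1 x t) (T.comps 1 x t) := by
  rw [T.qBar_eq hΔ, map_sub, conj_bil (A := T.mat x t) hΔ (S.conj_mat hx) (S.conj_comps_zero hx)
    (S.conj_comps_zero hx)]

/-! ### The dressed sources -/

lemma transform_phi (hΔ : T.Delta x t ≠ 0) (j : Fin m) :
    T.transform (lam j) (phi j) x t
      = T.dress (phi j x t) (T.brackets (lam j) (phi j x t) x t) x t :=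
  T.transform_eq_dress hΔ (S.poles_ne_params (.inl (.inl j))) _

lemma transform_w (hΔ : T.Delta x t ≠ 0) (j : Fin n) :
    T.transform (zeta j) (fun y s => realVec (w j y s)) x t
      = T.dress (realVec (w j x t)) (T.brackets (zeta j) (realVec (w j x t)) x t) x t :=
  T.transform_eq_dress hΔ (S.poles_ne_params (.inr j)) _

/-- For imaginary `ζ_j` the vector `(w, w*)` and its parameter are fixed by `S₊`, which commutes
with dressing; the dressed vector therefore has the same form. -/
lemma realVec_transform_w (hx : (x, t) ∈ Ω) (hΔ : T.Delta x t ≠ 0) (j : Fin n) :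
    realVec (T.transform (zeta j) (fun y s => realVec (w j y s)) x t 0)
      = T.dress (realVec (w j x t)) (T.brackets (zeta j) (realVec (w j x t)) x t) x t := by
  rw [S.transform_w hΔ]
  have h := S.sPlus_dress hx hΔ (realVec (w j x t)) (S.conj_brackets hx (zeta j) (realVec (w j x t)))
  rw [sPlus_realVec, neg_conj_of_re_eq_zero (S.sol.spectrum.zeta_re j)] at h
  refine fin_two_ext rfl ?_
  rw [realVec_one]
  exact congrFun h 1

lemma sources_oldPole (hx : (x, t) ∈ Ω) (hΔ : T.Delta x t ≠ 0) (k : (Fin m ⊕ Fin m) ⊕ Fin n) :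
    sources (T.phiBar lam phi) (T.wBar zeta w) x t (oldPole M N k)
      = T.dress (sources phi w x t k)
        (T.brackets (poles lam zeta k) (sources phi w x t k) x t) x t := by
  rcases k with (j | j) | j
  · simpa [sources, oldPole, DarbouxData.phiBar, poles] using S.transform_phi hΔ j
  · simp only [sources, oldPole, DarbouxData.phiBar, poles, Sum.map_inl, Sum.map_inr,
      Sum.elim_inl, Sum.elim_inr, Fin.append_left]
    rw [S.transform_phi hΔ j]
    exact S.sPlus_dress hx hΔ _ (S.conj_brackets hx _ _)
  · simpa [sources, oldPole, DarbouxData.wBar, poles] using S.realVec_transform_w hx hΔ j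

lemma wBar_natAdd (hx : (x, t) ∈ Ω) (hΔ : T.Delta x t ≠ 0) (j : Fin N) :
    realVec (T.wBar zeta w (Fin.natAdd n j) x t)
      = -T.dress 0 (T.roots t (.inl j) • Pi.single (.inl j) 1) x t := by
  have h0 : T.wBar zeta w (Fin.natAdd n j) x t
      = -T.dress 0 (T.roots t (.inl j) • Pi.single (.inl j) 1) x t 0 := by
    simp only [DarbouxData.wBar, Fin.append_right, T.W1Div_eq hΔ,
      DarbouxData.dress, bil_smul_right, Pi.zero_apply, DarbouxData.roots, Sum.elim_inl]
    field_simp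
    ring
  have h := S.sPlus_dress hx hΔ 0 (DarbouxData.conj_single (T.roots t (.inl j)) (.inl j))
  have e0 : sPlus 0 = 0 := fin_two_ext (by simp) (by simp)
  have e1 : conj (T.roots t (.inl j)) = T.roots t (.inl j) := by simp [DarbouxData.roots]
  rw [e0, e1] at h
  refine fin_two_ext h0 ?_
  rw [realVec_one, h0, map_neg]
  exact congrArg (fun z : ℂ => -z) (congrFun h 1)

lemma sources_newPole (hx : (x, t) ∈ Ω) (hΔ : T.Delta x t ≠ 0) (i : Fin N ⊕ (Fin M ⊕ Fin M)) :
    sources (T.phiBar lam phi) (T.wBar zeta w) x t (newPole m n i)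
      = -T.dress 0 (T.roots t i • Pi.single i 1) x t := by
  rcases i with j | j | j
  · exact S.wBar_natAdd hx hΔ j
  · exact T.phiBar_natAdd lam phi hΔ j
  · change sPlus (T.phiBar lam phi (Fin.natAdd m j) x t) = _
    rw [T.phiBar_natAdd lam phi hΔ]
    have h := S.sPlus_dress hx hΔ 0 (DarbouxData.conj_single (T.roots t (.inr (.inl j))) (.inr (.inl j)))
    have e0 : sPlus 0 = 0 := fin_two_ext (by simp) (by simp)
    rw [e0] at h
    refine Eq.trans ?_ (congrArg (fun z : Fin 2 → ℂ => -z) h)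
    exact fin_two_ext (by simp) (by simp)

/-! ### The spectral problem -/

lemma hasDerivAt_brackets_x (hx : (x, t) ∈ Ω) {mu : ℂ} (hmu : ∀ i, mu ≠ T.params i)
    {psi : ℝ → ℝ → Fin 2 → ℂ}
    (hpsi : HasDerivAt (fun y => psi y t)
      (laxU mu (q x t) (conj (q x t)) *ᵥ psi x t) x) :
    HasDerivAt (fun y => T.brackets mu (psi y t) y t)
      ((1 / 2 : ℂ) • (psi x t 1 • T.comps 0 x t + psi x t 0 • T.comps 1 x t)) x := by
  refine hasDerivAt_pi.2 fun i => ?_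
  have h := hasDerivAt_sigma_x (F := T.families i) (G := .single mu psi) (hmu i).symm
    ((S.families_lax i).isLaxSolution.psi_x x t hx) hpsi
  refine (h.congr_of_eventuallyEq (.of_forall fun y =>
    (sigma_single (hmu i).symm psi y t).symm)).congr_deriv ?_
  simp [DarbouxData.comps, SpectralFamily.single, SpectralFamily.val]
  ring

/-- The bracket vector `v` is free apart from its two relations, so both dressed solutions and the
new sources, with `p = 0` and `v` constant, are covered. -/
lemma hasDerivAt_dress_x (hx : (x, t) ∈ Ω) (hΔ : T.Delta x t ≠ 0) {nu : ℂ}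
    {p : ℝ → Fin 2 → ℂ} {v : ℝ → Fin N ⊕ (Fin M ⊕ Fin M) → ℂ}
    (hv : HasDerivAt v ((1 / 2 : ℂ) • (p x 1 • T.comps 0 x t + p x 0 • T.comps 1 x t)) x)
    (hmul : T.params * v x = nu • v x
      - (1 / 2 : ℂ) • (p x 1 • T.comps 0 x t - p x 0 • T.comps 1 x t))
    (hp : HasDerivAt p (laxU nu (q x t) (conj (q x t)) *ᵥ p x) x) :
    HasDerivAt (fun y => T.dress (p y) (v y) y t)
      (laxU nu (T.qBar q x t) (conj (T.qBar q x t)) *ᵥ T.dress (p x) (v x) x t) x := by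
  obtain ⟨h0, h1⟩ := hasDerivAt_fin_two.1 hp
  rw [laxU_mulVec_zero] at h0
  rw [laxU_mulVec_one] at h1
  obtain ⟨k0, k1⟩ := (S.isXFlow hx hΔ).hasDerivAt_dressed (f1 := fun y => p y 0)
    (f2 := fun y => p y 1) hv hmul h0 h1
  rw [hasDerivAt_fin_two, laxU_mulVec_zero, laxU_mulVec_one, S.conj_qBar hx hΔ, T.qBar_eq hΔ]
  exact ⟨k0, k1⟩

lemma hasDerivAt_transform_x (hx : (x, t) ∈ Ω) (hΔ : T.Delta x t ≠ 0) {mu : ℂ}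
    (hmu : ∀ i, mu ≠ T.params i) {psi : ℝ → ℝ → Fin 2 → ℂ}
    (hpsi : HasDerivAt (fun y => psi y t)
      (laxU mu (q x t) (conj (q x t)) *ᵥ psi x t) x) :
    HasDerivAt (fun y => T.transform mu psi y t)
      (laxU mu (T.qBar q x t) (conj (T.qBar q x t)) *ᵥ T.transform mu psi x t) x := by
  rw [T.transform_eq_dress hΔ hmu]
  have h := S.hasDerivAt_dress_x hx hΔ (nu := mu) (p := fun y => psi y t)
    (v := fun y => T.brackets mu (psi y t) y t)
    (S.hasDerivAt_brackets_x hx hmu hpsi) (T.mul_brackets hmu (psi x t) x t) hpsi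
  refine h.congr_of_eventuallyEq ?_
  filter_upwards [S.eventually_x hx hΔ] with y hy
  exact T.transform_eq_dress hy.2 hmu psi

lemma hasDerivAt_dress_single_x (hx : (x, t) ∈ Ω) (hΔ : T.Delta x t ≠ 0)
    (c : ℂ) (i : Fin N ⊕ (Fin M ⊕ Fin M)) :
    HasDerivAt (fun y => -T.dress 0 (c • Pi.single i 1) y t)
      (laxU (T.params i) (T.qBar q x t) (conj (T.qBar q x t)) *ᵥ
        -T.dress 0 (c • Pi.single i 1) x t) x := by
  have hv : HasDerivAt (fun _ : ℝ => c • (Pi.single i 1 : _ → ℂ))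
      ((1 / 2 : ℂ) • ((0 : Fin 2 → ℂ) 1 • T.comps 0 x t + (0 : Fin 2 → ℂ) 0 • T.comps 1 x t)) x := by
    simpa using hasDerivAt_const x (c • (Pi.single i 1 : _ → ℂ))
  have hmul : T.params * (c • Pi.single i 1) = T.params i • (c • Pi.single i 1)
      - (1 / 2 : ℂ) • ((0 : Fin 2 → ℂ) 1 • T.comps 0 x t - (0 : Fin 2 → ℂ) 0 • T.comps 1 x t) := by
    ext j
    by_cases h : j = i
    · simp [h]
    · simp [h]
  have hp : HasDerivAt (fun _ : ℝ => (0 : Fin 2 → ℂ))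
      (laxU (T.params i) (q x t) (conj (q x t)) *ᵥ (0 : Fin 2 → ℂ)) x := by
    simpa using hasDerivAt_const x (0 : Fin 2 → ℂ)
  have h := S.hasDerivAt_dress_x hx hΔ (nu := T.params i) (p := fun _ => 0)
    (v := fun _ => c • Pi.single i 1) hv hmul hp
  rw [mulVec_neg]
  exact h.neg

lemma hasDerivAt_sources_x (hx : (x, t) ∈ Ω) (k : (Fin m ⊕ Fin m) ⊕ Fin n) :
    HasDerivAt (fun y => sources phi w y t k)
      (laxU (poles lam zeta k) (q x t) (conj (q x t)) *ᵥ sources phi w x t k) x := by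
  rcases k with (j | j) | j
  · exact S.sol.phi_x j x t hx
  · have := hasDerivAt_sPlus (S.sol.phi_x j x t hx)
    rwa [sPlus_laxU] at this
  · have h := S.sol.w_x j x t hx
    rw [hasDerivAt_fin_two, laxU_mulVec_zero, laxU_mulVec_one]
    refine ⟨h, (HasDerivAt.conj h).congr_deriv ?_⟩
    have hz := neg_conj_of_re_eq_zero (S.sol.spectrum.zeta_re j)
    simp [poles, sources]
    linear_combination conj (w j x t) * hz

lemma hasDerivAt_sources_bar_x (hx : (x, t) ∈ Ω) (hΔ : T.Delta x t ≠ 0)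
    (k : (Fin m ⊕ Fin m) ⊕ Fin n) :
    HasDerivAt (fun y => sources (T.phiBar lam phi) (T.wBar zeta w) y t (oldPole M N k))
      (laxU (poles lam zeta k) (T.qBar q x t) (conj (T.qBar q x t)) *ᵥ
        sources (T.phiBar lam phi) (T.wBar zeta w) x t (oldPole M N k)) x := by
  have h := S.hasDerivAt_transform_x hx hΔ (S.poles_ne_params k)
    (psi := fun y s => sources phi w y s k) (S.hasDerivAt_sources_x hx k)
  have e : ∀ y, (y, t) ∈ Ω → T.Delta y t ≠ 0 →
      sources (T.phiBar lam phi) (T.wBar zeta w) y t (oldPole M N k)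
        = T.transform (poles lam zeta k) (fun y s => sources phi w y s k) y t := fun y hy hy' => by
    rw [S.sources_oldPole hy hy', T.transform_eq_dress hy' (S.poles_ne_params k)]
  rw [e x hx hΔ]
  refine h.congr_of_eventuallyEq ?_
  filter_upwards [S.eventually_x hx hΔ] with y hy
  exact e y hy.1 hy.2

lemma hasDerivAt_sources_bar_new_x (hx : (x, t) ∈ Ω) (hΔ : T.Delta x t ≠ 0)
    (i : Fin N ⊕ (Fin M ⊕ Fin M)) :
    HasDerivAt (fun y => sources (T.phiBar lam phi) (T.wBar zeta w) y t (newPole m n i))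
      (laxU (T.params i) (T.qBar q x t) (conj (T.qBar q x t)) *ᵥ
        sources (T.phiBar lam phi) (T.wBar zeta w) x t (newPole m n i)) x := by
  rw [S.sources_newPole hx hΔ]
  refine (S.hasDerivAt_dress_single_x hx hΔ _ i).congr_of_eventuallyEq ?_
  filter_upwards [S.eventually_x hx hΔ] with y hy
  exact S.sources_newPole hy.1 hy.2 i

/-! ### The new potential -/

lemma hasDerivAt_qBar_x (hx : (x, t) ∈ Ω) (hΔ : T.Delta x t ≠ 0) :
    HasDerivAt (fun y => T.qBar q y t)
      (deriv (fun y => q y t) x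
        - (2 * q x t * bil (T.mat x t) (T.comps 0 x t) (T.comps 1 x t)
          - bil (T.mat x t) (T.comps 0 x t) (T.comps 0 x t)
            * bil (T.mat x t) (T.comps 0 x t) (T.comps 1 x t)
          - 2 * bil (T.mat x t) (T.params * T.comps 0 x t) (T.comps 0 x t))) x := by
  have hq := (S.sol.q_x x t hx).1.self_of_nhds.hasDerivAt
  refine (hq.sub (S.isXFlow hx hΔ).hasDerivAt_bil_11).congr_of_eventuallyEq ?_
  filter_upwards [S.eventually_x hx hΔ] with y hy
  exact T.qBar_eq hy.2 q

lemma hasDerivAt_conj_qBar_x (hx : (x, t) ∈ Ω) (hΔ : T.Delta x t ≠ 0) :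
    HasDerivAt (fun y => conj (T.qBar q y t))
      (deriv (fun y => conj (q y t)) x
        - (2 * conj (q x t) * bil (T.mat x t) (T.comps 0 x t) (T.comps 1 x t)
          - bil (T.mat x t) (T.comps 0 x t) (T.comps 1 x t)
            * bil (T.mat x t) (T.comps 1 x t) (T.comps 1 x t)
          + 2 * bil (T.mat x t) (T.params * T.comps 1 x t) (T.comps 1 x t))) x := by
  have hq := HasDerivAt.conj (S.sol.q_x x t hx).1.self_of_nhds.hasDerivAt
  rw [deriv_conj]
  refine (hq.sub (S.isXFlow hx hΔ).hasDerivAt_bil_22).congr_of_eventuallyEq ?_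
  filter_upwards [S.eventually_x hx hΔ] with y hy
  exact S.conj_qBar hy.1 hy.2

lemma hasDerivAt_deriv_qBar (hx : (x, t) ∈ Ω) (hΔ : T.Delta x t ≠ 0) :
    HasDerivAt (deriv fun y => T.qBar q y t)
      (deriv (deriv fun y => q y t) x
        - (2 * (deriv (fun y => q y t) x * bil (T.mat x t) (T.comps 0 x t) (T.comps 1 x t)
            + q x t * (q x t * bil (T.mat x t) (T.comps 1 x t) (T.comps 1 x t)
              + conj (q x t) * bil (T.mat x t) (T.comps 0 x t) (T.comps 0 x t)
              - bil (T.mat x t) (T.comps 0 x t) (T.comps 0 x t)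
                * bil (T.mat x t) (T.comps 1 x t) (T.comps 1 x t)))
          - ((2 * q x t * bil (T.mat x t) (T.comps 0 x t) (T.comps 1 x t)
              - bil (T.mat x t) (T.comps 0 x t) (T.comps 0 x t)
                * bil (T.mat x t) (T.comps 0 x t) (T.comps 1 x t)
              - 2 * bil (T.mat x t) (T.params * T.comps 0 x t) (T.comps 0 x t))
              * bil (T.mat x t) (T.comps 0 x t) (T.comps 1 x t)
            + bil (T.mat x t) (T.comps 0 x t) (T.comps 0 x t)
              * (q x t * bil (T.mat x t) (T.comps 1 x t) (T.comps 1 x t)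
              + conj (q x t) * bil (T.mat x t) (T.comps 0 x t) (T.comps 0 x t)
              - bil (T.mat x t) (T.comps 0 x t) (T.comps 0 x t)
                * bil (T.mat x t) (T.comps 1 x t) (T.comps 1 x t)))
          - 2 * (-2 * bil (T.mat x t) (T.params * (T.params * T.comps 0 x t)) (T.comps 0 x t)
            + 2 * q x t * bil (T.mat x t) (T.params * T.comps 0 x t) (T.comps 1 x t)
            - q x t / 2 * (bil (T.mat x t) (T.comps 0 x t) (T.comps 0 x t)
              * bil (T.mat x t) (T.comps 1 x t) (T.comps 1 x t))
            + q x t / 2 * (bil (T.mat x t) (T.comps 0 x t) (T.comps 1 x t)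
              * bil (T.mat x t) (T.comps 0 x t) (T.comps 1 x t))
            - bil (T.mat x t) (T.params * T.comps 0 x t) (T.comps 1 x t)
              * bil (T.mat x t) (T.comps 0 x t) (T.comps 0 x t)))) x := by
  have hq := (S.sol.q_x x t hx).1.self_of_nhds.hasDerivAt
  have hqx := (S.sol.q_x x t hx).2.hasDerivAt
  have hX := S.isXFlow hx hΔ
  refine ((hqx.sub ((((hq.const_mul 2).mul hX.hasDerivAt_bil_12).sub
    (hX.hasDerivAt_bil_11.mul hX.hasDerivAt_bil_12)).sub
    (hX.hasDerivAt_bil_mul_11.const_mul 2))).congr_of_eventuallyEq ?_).congr_deriv ?_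
  · filter_upwards [S.eventually_x hx hΔ] with y hy
    exact (S.hasDerivAt_qBar_x hy.1 hy.2).deriv
  · ring

lemma sum_sq_sources_bar (hx : (x, t) ∈ Ω) (hΔ : T.Delta x t ≠ 0) :
    ∑ k, sources (T.phiBar lam phi) (T.wBar zeta w) x t k 0 ^ 2
      = ∑ k : ((Fin m ⊕ Fin m) ⊕ Fin n) ⊕ (Fin N ⊕ (Fin M ⊕ Fin M)),
        (Sum.elim (fun k => sources phi w x t k 0) 0 k
          - bil (T.mat x t) (T.comps 0 x t) (Sum.elim
            (fun k => T.brackets (poles lam zeta k) (sources phi w x t k) x t)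
            (fun i => T.roots t i • Pi.single i 1) k)) ^ 2 := by
  rw [sum_poles, Fintype.sum_sum_type (α₁ := (Fin m ⊕ Fin m) ⊕ Fin n)]
  congr 1
  · exact Finset.sum_congr rfl fun k _ => by rw [S.sources_oldPole hx hΔ]; rfl
  · refine Finset.sum_congr rfl fun i _ => ?_
    rw [S.sources_newPole hx hΔ, Pi.neg_apply, neg_sq]
    rfl

lemma hasDerivAt_qBar_t (hx : (x, t) ∈ Ω) (hΔ : T.Delta x t ≠ 0) :
    HasDerivAt (fun s => T.qBar q x s)
      (Complex.I * (2 * (‖T.qBar q x t‖ : ℂ) ^ 2 * T.qBar q x t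
          - deriv (deriv (fun y => T.qBar q y t)) x)
        + ∑ j, (T.phiBar lam phi j x t 0 ^ 2 + conj (T.phiBar lam phi j x t 1) ^ 2)
        + ∑ j, T.wBar zeta w j x t ^ 2) t := by
  have hq := S.sol.q_t x t hx
  have hb := (S.isTFlow hx hΔ).hasDerivAt_bil_11 (qxx := deriv (deriv fun y => q y t) x)
  rw [add_assoc, sum_sq_sources] at hq ⊢
  rw [S.sum_sq_sources_bar hx hΔ, (S.hasDerivAt_deriv_qBar hx hΔ).deriv, ← Complex.mul_conj',
    S.conj_qBar hx hΔ]
  rw [← Complex.mul_conj'] at hq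
  refine ((hq.sub hb).congr_of_eventuallyEq ?_).congr_deriv ?_
  · filter_upwards [S.eventually_t hx hΔ] with s hs
    exact T.qBar_eq hs.2 q
  · have e : ∑ k, sources phi w x t k 0 ^ 2
      = ∑ k : ((Fin m ⊕ Fin m) ⊕ Fin n) ⊕ (Fin N ⊕ (Fin M ⊕ Fin M)),
        (Sum.elim (fun k => sources phi w x t k 0) 0 k) ^ 2 := by
      simp [Fintype.sum_sum_type (α₁ := (Fin m ⊕ Fin m) ⊕ Fin n)]
    rw [e, T.qBar_eq hΔ]
    ring

/-! ### The time part of the Lax pair -/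

lemma hasDerivAt_brackets_t (hx : (x, t) ∈ Ω) {mu : ℂ} (hmu : ∀ i, mu ≠ T.params i)
    (hmu' : mu ∉ Set.range (poles lam zeta)) {psi : ℝ → ℝ → Fin 2 → ℂ}
    (hpsi : IsLaxSolution Ω lam zeta q phi w mu psi) :
    HasDerivAt (fun s => T.brackets mu (psi x s) x s)
      (Complex.I • ((psi x t 1 • (T.params * T.comps 0 x t)
          + psi x t 0 • (T.params * T.comps 1 x t))
        + mu • (psi x t 1 • T.comps 0 x t + psi x t 0 • T.comps 1 x t)
        + (conj (q x t) * psi x t 0) • T.comps 0 x t - (q x t * psi x t 1) • T.comps 1 x t)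
      + ∑ k, bracket (poles lam zeta k) (sources phi w x t k) mu (psi x t)
        • T.brackets (poles lam zeta k) (sources phi w x t k) x t) t := by
  refine hasDerivAt_pi.2 fun i => ?_
  have h := hasDerivAt_sigma_t (F := T.families i) (G := .single mu psi) (hmu i).symm
    (S.families_lax i).isLaxSolution hpsi (S.params_notMem i) hmu' hx
  refine (h.congr_of_eventuallyEq (.of_forall fun s =>
    (sigma_single (hmu i).symm psi x s).symm)).congr_deriv ?_
  simp only [DarbouxData.comps, DarbouxData.params, DarbouxData.brackets, SpectralFamily.single,
    SpectralFamily.val, Pi.add_apply, Pi.sub_apply, Pi.smul_apply, Pi.mul_apply, smul_eq_mul,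
    Finset.sum_apply]
  congr 1
  · ring
  · exact Finset.sum_congr rfl fun k _ => mul_comm _ _

/-- Dressing both arguments shifts a bracket by `bil`. This matches the coefficient `c - bil v b`
which the time flow assigns to each source. -/
lemma bracket_dress (hΔ : T.Delta x t ≠ 0) {la mu : ℂ} (hla : mu ≠ la) {p f : Fin 2 → ℂ}
    {v b : _ → ℂ} {c : ℂ}
    (hv : T.params * v = la • v + (1 / 2 : ℂ) • (p 0 • T.comps 1 x t - p 1 • T.comps 0 x t))
    (hb : T.params * b = mu • b - (1 / 2 : ℂ) • (f 1 • T.comps 0 x t - f 0 • T.comps 1 x t))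
    (hc : p 0 * f 1 - p 1 * f 0 = -2 * (la - mu) * c) :
    bracket la (T.dress p v x t) mu (T.dress f b x t) = c - bil (T.mat x t) v b := by
  have h := (S.isCauchyLike hΔ).wronskian_dressed hv hb hc
  have h0 := sub_ne_zero.2 hla
  rw [bracket, div_eq_iff (mul_ne_zero two_ne_zero h0), wronskian]
  refine h.trans ?_
  ring

lemma sum_bracket_sources_bar (hx : (x, t) ∈ Ω) (hΔ : T.Delta x t ≠ 0) {mu : ℂ}
    (hmu : ∀ i, mu ≠ T.params i) (hmu' : ∀ k, mu ≠ poles lam zeta k) (f : Fin 2 → ℂ) (c : Fin 2) :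
    ∑ k, bracket (poles (Fin.append lam T.lam) (Fin.append zeta T.zeta) k)
        (sources (T.phiBar lam phi) (T.wBar zeta w) x t k) mu
        (T.dress f (T.brackets mu f x t) x t)
      * sources (T.phiBar lam phi) (T.wBar zeta w) x t k c
    = ∑ k : ((Fin m ⊕ Fin m) ⊕ Fin n) ⊕ (Fin N ⊕ (Fin M ⊕ Fin M)),
      (Sum.elim (fun k => bracket (poles lam zeta k) (sources phi w x t k) mu f) 0 k
        - bil (T.mat x t) (Sum.elim
          (fun k => T.brackets (poles lam zeta k) (sources phi w x t k) x t)
          (fun i => T.roots t i • Pi.single i 1) k) (T.brackets mu f x t))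
      * (Sum.elim (fun k => sources phi w x t k c) 0 k
        - bil (T.mat x t) (T.comps c x t) (Sum.elim
          (fun k => T.brackets (poles lam zeta k) (sources phi w x t k) x t)
          (fun i => T.roots t i • Pi.single i 1) k)) := by
  have hs := (S.isTFlow hx hΔ).source
  have hb := T.mul_brackets hmu f x t
  rw [sum_poles, Fintype.sum_sum_type (α₁ := (Fin m ⊕ Fin m) ⊕ Fin n)]
  congr 1
  · refine Finset.sum_congr rfl fun k _ => ?_
    rw [S.sources_oldPole hx hΔ, poles_oldPole, S.bracket_dress hΔ (hmu' k)
      (p := sources phi w x t k)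
      (v := T.brackets (poles lam zeta k) (sources phi w x t k) x t) (hs (.inl k)) hb
      (c := bracket (poles lam zeta k) (sources phi w x t k) mu f)]
    · rfl
    · rw [two_mul_bracket (hmu' k)]
      ring
  · refine Finset.sum_congr rfl fun i _ => ?_
    rw [S.sources_newPole hx hΔ, poles_newPole, bracket_neg,
      -- A fictitious source has zero vector and zero bracket; the minus signs in the bracket and in
      -- the source vector cancel.
      S.bracket_dress hΔ (hmu i) (p := 0) (v := T.roots t i • Pi.single i 1)
        (hs (.inr i)) hb (c := 0) (by simp), Pi.neg_apply, neg_mul_neg]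
    rfl

lemma hasDerivAt_transform_t (hx : (x, t) ∈ Ω) (hΔ : T.Delta x t ≠ 0) {mu : ℂ}
    (hmu : ∀ i, mu ≠ T.params i) (hmu' : ∀ k, mu ≠ poles lam zeta k)
    {psi : ℝ → ℝ → Fin 2 → ℂ} (hpsi : IsLaxSolution Ω lam zeta q phi w mu psi) :
    HasDerivAt (fun s => T.transform mu psi x s)
      (laxR (Fin.append lam T.lam) (Fin.append zeta T.zeta) (T.qBar q) (T.phiBar lam phi)
        (T.wBar zeta w) mu x t *ᵥ T.transform mu psi x t) t := by
  obtain ⟨h0, h1⟩ := hasDerivAt_fin_two.1 (hpsi.psi_t x t hx)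
  rw [laxR_mulVec_zero] at h0
  rw [laxR_mulVec_one] at h1
  have hb := S.hasDerivAt_brackets_t hx hmu (by rintro ⟨k, hk⟩; exact hmu' k hk.symm) hpsi
  obtain ⟨k0, k1⟩ := (S.isTFlow hx hΔ).hasDerivAt_dressed
    (f1 := fun s => psi x s 0) (f2 := fun s => psi x s 1)
    (b := fun s => T.brackets mu (psi x s) x s) (nu := mu)
    (c := Sum.elim (fun k => bracket (poles lam zeta k) (sources phi w x t k) mu (psi x t)) 0)
    (by simpa [Fintype.sum_sum_type (α₁ := (Fin m ⊕ Fin m) ⊕ Fin n)] using! hb)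
    (T.mul_brackets hmu (psi x t) x t)
    (by simpa [Fintype.sum_sum_type (α₁ := (Fin m ⊕ Fin m) ⊕ Fin n)] using! h0)
    (by simpa [Fintype.sum_sum_type (α₁ := (Fin m ⊕ Fin m) ⊕ Fin n)] using! h1)
  rw [T.transform_eq_dress hΔ hmu]
  have he : (fun s => T.transform mu psi x s)
      =ᶠ[𝓝 t] fun s => T.dress (psi x s) (T.brackets mu (psi x s) x s) x s := by
    filter_upwards [S.eventually_t hx hΔ] with s hs
    exact T.transform_eq_dress hs.2 hmu psi
  refine HasDerivAt.congr_of_eventuallyEq ?_ he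
  rw [hasDerivAt_fin_two, laxR_mulVec_zero, laxR_mulVec_one,
    S.sum_bracket_sources_bar hx hΔ hmu hmu', S.sum_bracket_sources_bar hx hΔ hmu hmu',
    (S.hasDerivAt_qBar_x hx hΔ).deriv, (S.hasDerivAt_conj_qBar_x hx hΔ).deriv,
    S.conj_qBar hx hΔ, T.qBar_eq hΔ]
  exact ⟨k0, k1⟩

/-! ### The logarithm of the determinant -/

/-- `Real.log` takes the logarithm of the absolute value, so reality and nonvanishing of the
determinant suffice, whatever its sign. -/
lemma hasDerivAt_log_Delta (hx : (x, t) ∈ Ω) (hΔ : T.Delta x t ≠ 0) :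
    HasDerivAt (fun y => Real.log (T.Delta y t).re)
      (bil (T.mat x t) (T.comps 0 x t) (T.comps 1 x t)).re x := by
  have him : (T.Delta x t).im = 0 := Complex.conj_eq_iff_im.1 (S.conj_Delta hx)
  have hre : (T.Delta x t).re ≠ 0 := fun h => hΔ (Complex.ext h him)
  have h1 : HasDerivAt (fun y => (T.Delta y t).re)
      (T.Delta x t * bil (T.mat x t) (T.comps 0 x t) (T.comps 1 x t)).re x :=
    Complex.reCLM.hasFDerivAt.comp_hasDerivAt x (S.isXFlow hx hΔ).hasDerivAt_det
  refine (h1.log hre).congr_deriv ?_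
  rw [Complex.mul_re, him, zero_mul, sub_zero, mul_div_cancel_left₀ _ hre]

lemma hasDerivAt_deriv_log_Delta (hx : (x, t) ∈ Ω) (hΔ : T.Delta x t ≠ 0) :
    HasDerivAt (deriv fun y => Real.log (T.Delta y t).re)
      (‖q x t‖ ^ 2 - ‖T.qBar q x t‖ ^ 2) x := by
  have h1 := Complex.reCLM.hasFDerivAt.comp_hasDerivAt x (S.isXFlow hx hΔ).hasDerivAt_bil_12
  have he : (deriv fun y => Real.log (T.Delta y t).re)
      =ᶠ[𝓝 x] fun y => (bil (T.mat y t) (T.comps 0 y t) (T.comps 1 y t)).re := by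
    filter_upwards [S.eventually_x hx hΔ] with y hy
    exact (S.hasDerivAt_log_Delta hy.1 hy.2).deriv
  refine (HasDerivAt.congr_of_eventuallyEq h1 he).congr_deriv ?_
  rw [Complex.reCLM_apply, ← Complex.ofReal_re (‖q x t‖ ^ 2 - ‖T.qBar q x t‖ ^ 2)]
  congr 1
  push_cast
  rw [← Complex.mul_conj', ← Complex.mul_conj', S.conj_qBar hx hΔ, T.qBar_eq hΔ]
  ring

end IsDarbouxSetup

end NLSESCS

/-! ### Assembly of the theorem -/

theorem mainTheorem4 {m n M N : ℕ} (Ω : Set (ℝ × ℝ)) (hΩ : IsOpen Ω)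
    (lam : Fin m → ℂ) (zeta : Fin n → ℂ)
    (q : ℝ → ℝ → ℂ) (phi : Fin m → ℝ → ℝ → Fin 2 → ℂ) (w : Fin n → ℝ → ℝ → ℂ)
    (hsol : NLSESCS.IsSolution Ω lam zeta q phi w)
    (T : NLSESCS.DarbouxData M N)
    (hspec : NLSESCS.AdmissibleSpectrum (Fin.append lam T.lam) (Fin.append zeta T.zeta))
    (hf : ∀ j, NLSESCS.IsLaxFamily Ω lam zeta q phi w (T.fFam j))
    (hf_conj : ∀ j, NLSESCS.IsSelfConjugate Ω (T.fFam j))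
    (hc : ∀ j, ∀ x t, (x, t) ∈ Ω → DifferentiableAt ℝ (T.c j) t ∧ 0 ≤ deriv (T.c j) t)
    (hg : ∀ j, NLSESCS.IsLaxFamily Ω lam zeta q phi w (T.gFam j))
    (hg_re : ∀ j, (T.lam j).re ≠ 0)
    (hd : ∀ j, ∀ x t, (x, t) ∈ Ω → DifferentiableAt ℝ (T.d j) t)
    (D : Set (ℝ × ℝ)) (hD : D = {p ∈ Ω | T.Delta p.1 p.2 ≠ 0}) :
    (∀ mu, mu ∉ Set.range
          (NLSESCS.poles (Fin.append lam T.lam) (Fin.append zeta T.zeta)) →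
        ∀ psi, NLSESCS.IsLaxSolution Ω lam zeta q phi w mu psi →
          NLSESCS.IsLaxSolution D (Fin.append lam T.lam) (Fin.append zeta T.zeta)
            (T.qBar q) (T.phiBar lam phi) (T.wBar zeta w) mu (T.transform mu psi)) ∧
    NLSESCS.IsSolution D (Fin.append lam T.lam) (Fin.append zeta T.zeta)
        (T.qBar q) (T.phiBar lam phi) (T.wBar zeta w) ∧
    (∀ x t, (x, t) ∈ Ω → (T.Delta x t).im = 0) ∧
    (∀ x t, (x, t) ∈ D →
        NLSESCS.TwiceDifferentiableAt (fun y => Real.log (T.Delta y t).re) x ∧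
        ‖T.qBar q x t‖ ^ 2
          = ‖q x t‖ ^ 2 - deriv (deriv (fun y => Real.log (T.Delta y t).re)) x) := by
  have S : NLSESCS.IsDarbouxSetup Ω lam zeta q phi w T :=
    ⟨hΩ, hsol, hspec, hf, hf_conj, hc, hg, hd⟩
  subst hD
  refine ⟨fun mu hmu psi hpsi => ?_, ?_, fun x t hx =>
    Complex.conj_eq_iff_im.1 (S.conj_Delta hx), fun x t hx => ⟨⟨?_, ?_⟩, ?_⟩⟩
  · have h1 : ∀ i, mu ≠ T.params i := fun i h =>
      hmu ⟨NLSESCS.newPole m n i, (NLSESCS.poles_newPole T lam zeta i).trans h.symm⟩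
    have h2 : ∀ k, mu ≠ NLSESCS.poles lam zeta k := fun k h =>
      hmu ⟨NLSESCS.oldPole M N k, (NLSESCS.poles_oldPole lam zeta T.lam T.zeta k).trans h.symm⟩
    exact ⟨fun x t hx => S.hasDerivAt_transform_x hx.1 hx.2 h1 (hpsi.psi_x x t hx.1),
      fun x t hx => S.hasDerivAt_transform_t hx.1 hx.2 h1 h2 hpsi⟩
  · refine ⟨hspec, fun j => ?_, fun j => ?_, fun x t hx => ⟨?_, ?_⟩, fun x t hx =>
      S.hasDerivAt_qBar_t hx.1 hx.2⟩
    · refine Fin.addCases (fun j x t hx => ?_) (fun j x t hx => ?_) j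
      · rw [Fin.append_left]
        exact S.hasDerivAt_sources_bar_x hx.1 hx.2 (.inl (.inl j))
      · rw [Fin.append_right]
        exact S.hasDerivAt_sources_bar_new_x hx.1 hx.2 (.inr (.inl j))
    · refine Fin.addCases (fun j x t hx => ?_) (fun j x t hx => ?_) j
      · have h := (NLSESCS.hasDerivAt_fin_two.1
          (S.hasDerivAt_sources_bar_x hx.1 hx.2 (.inr j))).1
        rw [NLSESCS.laxU_mulVec_zero] at h
        rw [Fin.append_left]
        exact h
      · have h := (NLSESCS.hasDerivAt_fin_two.1
          (S.hasDerivAt_sources_bar_new_x hx.1 hx.2 (.inl j))).1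
        rw [NLSESCS.laxU_mulVec_zero] at h
        rw [Fin.append_right]
        exact h
    · filter_upwards [S.eventually_x hx.1 hx.2] with y hy
      exact (S.hasDerivAt_qBar_x hy.1 hy.2).differentiableAt
    · exact (S.hasDerivAt_deriv_qBar hx.1 hx.2).differentiableAt
  · filter_upwards [S.eventually_x hx.1 hx.2] with y hy
    exact (S.hasDerivAt_log_Delta hy.1 hy.2).differentiableAt
  · exact (S.hasDerivAt_deriv_log_Delta hx.1 hx.2).differentiableAt
  · rw [(S.hasDerivAt_deriv_log_Delta hx.1 hx.2).deriv]
    ring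

end
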